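/- Fix an integer $q\ge 1$, a number $\alpha\in(0,1)$ and a positive definite matrix $V\in\mathbb R^{q\times q}$ with smallest and largest eigenvalues $\underline\lambda_v$ and $\bar\lambda_v$. For every $n\ge 1$ let $X\in\mathbb R^{p\times n}$ be a fixed design matrix with $p=p_n$, let $M_o\subseteq\{1,\dots,p\}$, and let $B^0\in\mathbb R^{q\times|M_o|}$ ($X$, $M_o$ and $B^0$ may depend on $n$). For $M\subseteq\{1,\dots,p\}$ write $X_M\in\mathbb R^{|M|\times n}$ for the submatrix of the rows of $X$ with index in $M$ and $H_{(M)}$ for the orthogonal projection of $\mathbb R^n$ onto the row space of $X_M$. The data $Y\in\mathbb R^{q\times n}$ has independent columns, the $i$-th being normal with mean the $i$-th column of $B^0X_{M_o}$ and covariance $V$; $\mathbb P_y$ denotes its law. Assume that $\log p=o(n^{1-\alpha})$ as $n\to\infty$ and that, for all large $n$, $|M_o|\le n^\alpha$ and $X_{M_o}X_{M_o}^\top$ is nonsingular. Put $\widehat\Sigma_{(M)}=Y(I_n-H_{(M)})Y^\top$ and $\widehat B_M=YX_M^\top(X_MX_M^\top)^{-1}$. For $\epsilon>0$ and $B_M\in\mathbb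 R^{q\times|M|}$ let $$h_\epsilon(B_M)=\mathrm I\Big\{\tfrac12\min_{B}\big\|\widehat\Sigma_{(M)}^{-1/2}(B_MX_M-BX)\big\|_F^2\ge\epsilon\Big\}\,\mathrm I\{|M|<n-q\},$$ where the minimum is over the $B\in\mathbb R^{q\times p}$ with at most $|M|-1$ nonzero columns. Given $Y$, let $\mathbb E(h_\epsilon(B_M))$ be the expectation of $h_\epsilon(B_M)$ when $B_M$ has the generalized fiducial distribution, i.e. the matrix $t$-distribution $T_{q,|M|}\big(n-|M|-q+1,\widehat B_M,\widehat\Sigma_{(M)},(X_MX_M^\top)^{-1}\big)$, whose Lebesgue density is proportional to $$\det\!\big(I_q+\widehat\Sigma_{(M)}^{-1}(B_M-\widehat B_M)X_MX_M^\top(B_M-\widehat B_M)^\top\big)^{-n/2}$$ (if $X_M$ does not have full row rank, then $h_\epsilon$ vanishes identically and $\mathbb E(h_\epsilon(B_M))=0$). Then for all sufficiently large $n$ and for every $\epsilon>0$ that satisfies the redundancy condition $$\frac{9}{\underline\lambda_v(n-|M|)}\,\min_{j\in M}\big\|B^0X_{M_o}(H_{(M)}-H_{(M\setminus\{j\})})\big\|_F^2<\epsilon\qquad\text{for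 all } M\not\subseteq M_o \text{ with } |M|\le n^\alpha,$$ one has $$\mathbb P_y\Big[\bigcap_{M\not\subseteq M_o,\ |M|\le n^\alpha}\Big\{\mathbb E(h_\epsilon(B_M))\le\exp\Big(-\frac{\epsilon(n-|M|)}{36}+\frac{q|M|}{2}\Big)+2\exp\Big(-\frac18\big(\sqrt{n-|M|}-2\sqrt q\big)^2\Big)\Big\}\Big]\ge 1-V_{4,n},$$ where $$V_{4,n}=n^\alpha\Big\{\exp\Big(-\frac{\epsilon(n-n^\alpha)\underline\lambda_v}{36\,\bar\lambda_v}+\frac{qn^\alpha}{2}+n^\alpha\log p\Big)+2\exp\big(-0.04(n-n^\alpha)+n^\alpha\log p\big)\Big\}.$$ -/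

import Mathlib

open MeasureTheory ProbabilityTheory Filter Asymptotics
open scoped MatrixOrder

noncomputable section

namespace EAS

/-- The squared Frobenius norm of a real matrix. -/
def frobSq {ι κ : Type*} [Fintype ι] [Fintype κ] (D : Matrix ι κ ℝ) : ℝ :=
  ∑ i, ∑ j, D i j ^ 2

/-- The principal inverse square root `A ^ (-1/2)` of a positive definite matrix. -/
def invSqrt {q : ℕ} (A : Matrix (Fin q) (Fin q) ℝ) : Matrix (Fin q) (Fin q) ℝ :=
  (CFC.sqrt A)⁻¹

/-- The smallest eigenvalue of a real symmetric matrix. -/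
def eigMin {q : ℕ} (V : Matrix (Fin q) (Fin q) ℝ) : ℝ := sInf (spectrum ℝ V)

/-- The largest eigenvalue of a real symmetric matrix. -/
def eigMax {q : ℕ} (V : Matrix (Fin q) (Fin q) ℝ) : ℝ := sSup (spectrum ℝ V)

/-! ### The sampling model -/

/-- A sample of `n` response vectors in `ℝ^q`, stacked as the columns of a `q × n` matrix. -/
def dataMatrix {q n : ℕ} (y : Fin n → EuclideanSpace ℝ (Fin q)) : Matrix (Fin q) (Fin n) ℝ :=
  Matrix.of fun a i => y i a

/-- The law `Matrix-Normal_{q,n}(μ, V, I_n)`: the `n` columns are independent, the `i`-th one is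
normal with mean the `i`-th column of `μ` and covariance `V`. -/
def matrixNormal {q n : ℕ} (μ : Matrix (Fin q) (Fin n) ℝ) (V : Matrix (Fin q) (Fin q) ℝ) :
    Measure (Fin n → EuclideanSpace ℝ (Fin q)) :=
  Measure.pi fun i => multivariateGaussian (WithLp.toLp 2 fun a => μ a i) V

/-! ### Least squares for a model `M` -/

/-- The rows of the design matrix with indices in the model `M`. -/
def rowsOf {p n : ℕ} (X : Matrix (Fin p) (Fin n) ℝ) (M : Finset (Fin p)) : Matrix M (Fin n) ℝ :=
  X.submatrix (fun j => (j : Fin p)) id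

/-- The matrix of the orthogonal projection of `ℝ^n` onto the row space of `X_M`; it is
`X_Mᵀ (X_M X_Mᵀ)⁻¹ X_M` when `X_M` has full row rank. -/
def hatMatrix {p n : ℕ} (X : Matrix (Fin p) (Fin n) ℝ) (M : Finset (Fin p)) :
    Matrix (Fin n) (Fin n) ℝ :=
  (Matrix.toEuclideanCLM (n := Fin n) (𝕜 := ℝ)).symm
    (Submodule.span ℝ
      (Set.range fun j : M => (WithLp.toLp 2 (X j) : EuclideanSpace ℝ (Fin n)))).starProjection

/-- The least squares estimator of the coefficients of the model `M`. -/
def bHat {p q n : ℕ} (X : Matrix (Fin p) (Fin n) ℝ) (Y : Matrix (Fin q) (Fin n) ℝ)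
    (M : Finset (Fin p)) : Matrix (Fin q) M ℝ :=
  Y * (rowsOf X M).transpose * (rowsOf X M * (rowsOf X M).transpose)⁻¹

/-- The residual matrix `Y (I - H_M) Yᵀ` of the model `M`. -/
def sigmaHat {p q n : ℕ} (X : Matrix (Fin p) (Fin n) ℝ) (Y : Matrix (Fin q) (Fin n) ℝ)
    (M : Finset (Fin p)) : Matrix (Fin q) (Fin q) ℝ :=
  Y * (1 - hatMatrix X M) * Y.transpose

/-! ### Admissibility -/

/-- The coefficient matrices with at most `|M| - 1` nonzero columns. -/
def sparser {p : ℕ} (q : ℕ) (M : Finset (Fin p)) : Set (Matrix (Fin q) (Fin p) ℝ) :=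
  {B | {j : Fin p | (fun a => B a j) ≠ 0}.ncard + 1 ≤ M.card}

/-- The objective `‖Σ̂_M ^ (-1/2) (B_M X_M - B X)‖_F²`. -/
def objective {p q n : ℕ} (X : Matrix (Fin p) (Fin n) ℝ) (Y : Matrix (Fin q) (Fin n) ℝ)
    (M : Finset (Fin p)) (BM : Matrix (Fin q) M ℝ) (B : Matrix (Fin q) (Fin p) ℝ) : ℝ :=
  frobSq (invSqrt (sigmaHat X Y M) * (BM * rowsOf X M - B * X))

/-- `B_M` is `ε`-admissible: half of the minimum of the objective over the sparser coefficient
matrices is at least `ε`, and `|M| < n - q`. -/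
def Admissible {p q n : ℕ} (X : Matrix (Fin p) (Fin n) ℝ) (Y : Matrix (Fin q) (Fin n) ℝ)
    (ε : ℝ) (M : Finset (Fin p)) (BM : Matrix (Fin q) M ℝ) : Prop :=
  (∃ Bmin ∈ sparser q M, IsMinOn (objective X Y M BM) (sparser q M) Bmin ∧
      ε ≤ (1 / 2) * objective X Y M BM Bmin) ∧
    M.card + q < n

open scoped Classical in
/-- The function `h_ε`, the indicator of `ε`-admissibility. -/
def hFun {p q n : ℕ} (X : Matrix (Fin p) (Fin n) ℝ) (Y : Matrix (Fin q) (Fin n) ℝ)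
    (ε : ℝ) (M : Finset (Fin p)) (BM : Matrix (Fin q) M ℝ) : ℝ :=
  if Admissible X Y ε M BM then 1 else 0

/-! ### The fiducial distribution -/

/-- The density, up to its normalizing constant, of the matrix `t`-distribution
`T_{ι,κ}(ν, μ, S, Ω)`. -/
def matrixTKernel {ι κ : Type*} [Fintype ι] [Fintype κ] [DecidableEq ι] [DecidableEq κ]
    (ν : ℝ) (μ : Matrix ι κ ℝ) (S : Matrix ι ι ℝ) (Ω : Matrix κ κ ℝ) (T : Matrix ι κ ℝ) : ℝ :=
  (1 + S⁻¹ * (T - μ) * Ω⁻¹ * (T - μ).transpose).det ^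
    (-(ν + (Fintype.card ι : ℝ) + (Fintype.card κ : ℝ) - 1) / 2)

/-- The matrix `t`-distribution `T_{ι,κ}(ν, μ, S, Ω)`, as a measure on the arrays of entries: its
density with respect to Lebesgue measure is the kernel divided by its integral. -/
def matrixT {ι κ : Type*} [Fintype ι] [Fintype κ] [DecidableEq ι] [DecidableEq κ]
    (ν : ℝ) (μ : Matrix ι κ ℝ) (S : Matrix ι ι ℝ) (Ω : Matrix κ κ ℝ) : Measure (ι → κ → ℝ) :=
  (∫⁻ T : ι → κ → ℝ, ENNReal.ofReal (matrixTKernel ν μ S Ω (Matrix.of T)))⁻¹ •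
    (volume : Measure (ι → κ → ℝ)).withDensity fun T =>
      ENNReal.ofReal (matrixTKernel ν μ S Ω (Matrix.of T))

/-- The generalized fiducial distribution of the coefficients `B_M` given the data `Y`. -/
def fiducial {p q n : ℕ} (X : Matrix (Fin p) (Fin n) ℝ) (Y : Matrix (Fin q) (Fin n) ℝ)
    (M : Finset (Fin p)) : Measure (Fin q → M → ℝ) :=
  matrixT ((n : ℝ) - (M.card : ℝ) - (q : ℝ) + 1) (bHat X Y M) (sigmaHat X Y M)
    (rowsOf X M * (rowsOf X M).transpose)⁻¹

/-- The fiducial expectation `E(h_ε(B_M))` given the data `Y`. -/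
def expectedH {p q n : ℕ} (X : Matrix (Fin p) (Fin n) ℝ) (Y : Matrix (Fin q) (Fin n) ℝ)
    (ε : ℝ) (M : Finset (Fin p)) : ℝ :=
  ∫ T, hFun X Y ε M (Matrix.of T) ∂(fiducial X Y M)

/-! ### The redundancy condition and the two bounds -/

/-- `‖B⁰ X_{M_o} (H_M - H_{M \ {j}})‖_F²`, the change of the mean prediction when the predictor `j`
is dropped from `M`. -/
def dropChange {p q n : ℕ} (X : Matrix (Fin p) (Fin n) ℝ) (Mo : Finset (Fin p))
    (B0 : Matrix (Fin q) Mo ℝ) (M : Finset (Fin p)) (j : Fin p) : ℝ :=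
  frobSq (B0 * rowsOf X Mo * (hatMatrix X M - hatMatrix X (M.erase j)))

/-- The redundancy condition on `ε` at sample size `n`. -/
def Redundancy {p q n : ℕ} (α : ℝ) (X : Matrix (Fin p) (Fin n) ℝ) (Mo : Finset (Fin p))
    (B0 : Matrix (Fin q) Mo ℝ) (V : Matrix (Fin q) (Fin q) ℝ) (ε : ℝ) : Prop :=
  ∀ M : Finset (Fin p), ¬ M ⊆ Mo → (M.card : ℝ) ≤ (n : ℝ) ^ α →
    ∃ j ∈ M, (∀ i ∈ M, dropChange X Mo B0 M j ≤ dropChange X Mo B0 M i) ∧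
      9 / (eigMin V * ((n : ℝ) - (M.card : ℝ))) * dropChange X Mo B0 M j < ε

/-- The bound on the fiducial expectation for a model of size `m`. -/
def hBound (n q m : ℕ) (ε : ℝ) : ℝ :=
  Real.exp (-(ε * ((n : ℝ) - (m : ℝ))) / 36 + (q : ℝ) * (m : ℝ) / 2) +
    2 * Real.exp (-(1 / 8) * (Real.sqrt ((n : ℝ) - (m : ℝ)) - 2 * Real.sqrt (q : ℝ)) ^ 2)

/-- The bound `V_{4,n}` on the exceptional probability. -/
def v4 (n p : ℕ) {q : ℕ} (α : ℝ) (V : Matrix (Fin q) (Fin q) ℝ) (ε : ℝ) : ℝ :=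
  (n : ℝ) ^ α *
    (Real.exp (-(ε * ((n : ℝ) - (n : ℝ) ^ α) * eigMin V) / (36 * eigMax V) +
        (q : ℝ) * (n : ℝ) ^ α / 2 + (n : ℝ) ^ α * Real.log (p : ℝ)) +
      2 * Real.exp (-0.04 * ((n : ℝ) - (n : ℝ) ^ α) + (n : ℝ) ^ α * Real.log (p : ℝ)))

end EAS

end

/-!
Fix a model `M`, put `k = n - |M|`, `μ = B⁰ X_{M_o}`, and let `j ∈ M` be the predictor given by the
redundancy condition. Let `r` be the component of the row `x_j` orthogonal to the other rows of
`X_M`, and `u = r / ‖r‖`.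

*Reduction to one direction.* Absorbing the predictor `j` into the others is one of the sparser
approximations of `B_M X_M`, and its error is `b_j rᵀ` with `b_j` the column `j` of `B_M`
(`exists_sparser_sub_eq`). So `ε`-admissibility forces `2ε ≤ ‖Σ̂^(-1/2) b_j‖² ‖r‖²`. If some such
residual vanishes, nothing is admissible; otherwise `X_M` has full row rank, and
`‖r‖ Σ̂^(-1/2) b_j = Σ̂^(-1/2) Y u + t`, where `t` is the column `j` of a standardized matrix
`t`-distributed array.

*The fiducial part.* Integrating out the other columns, by the substitution `c ↦ (1 + t tᵀ)^(1/2) c`,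
leaves for `t` a density proportional to `(1 + ‖t‖²)^(-(k+1)/2)` (`exists_lintegral_column`); only
ratios of integrals matter, so no normalizing constant is computed. Comparison with Gaussian
integrals bounds the probability of `‖t‖ ≥ (3/8)√ε` by the right-hand side `hBound`
(`exists_lintegral_tail_le`).

*The data part.* Write `Y = μ + V^(1/2) Z` with a standard Gaussian matrix `Z`. There are at least
`k - q` orthonormal directions `w_i` orthogonal to the rows of `X_M` and of `μ`, and
`Σ̂ ≥ V^(1/2) (∑ (Z w_i) (Z w_i)ᵀ) V^(1/2)`. Chernoff bounds on a finite net of the unit sphere of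
`ℝ^q` give `Σ̂ ≥ 0.65² k V`, outside of an event of probability at most `2 exp (-0.04 k)`. Then the
redundancy condition makes the signal part `Σ̂^(-1/2) μ u` at most `√ε / (3 · 0.65)`, and so is the
noise part `Σ̂^(-1/2) V^(1/2) Z u` unless `‖Z u‖² > ε k / 9` (`standardized_data_le`). Since
`3/8 + 2 / (3 · 0.65) < √2`, admissibility then needs `‖t‖ ≥ (3/8)√ε`
(`expectedH_le`, `exists_forall_model`). A union bound over the at most `n^α p^(n^α)` models ends the
proof.
-/

noncomputable section

namespace EAS

/-! ### A column of the matrix `t`-distribution -/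

/-- A linear change of variables multiplies all integrals by one and the same constant. -/
lemma exists_lintegral_comp_linearEquiv {E F : Type*}
    [NormedAddCommGroup E] [NormedSpace ℝ E] [FiniteDimensional ℝ E]
    [MeasurableSpace E] [BorelSpace E]
    [NormedAddCommGroup F] [NormedSpace ℝ F] [FiniteDimensional ℝ F]
    [MeasurableSpace F] [BorelSpace F]
    (μ : Measure E) [μ.IsAddHaarMeasure] (ν : Measure F) [ν.IsAddHaarMeasure] (Φ : E ≃ₗ[ℝ] F) :
    ∃ c : ENNReal, ∀ f : F → ENNReal, Measurable f → ∫⁻ x, f (Φ x) ∂μ = c * ∫⁻ y, f y ∂ν := by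
  have h1 : (μ.map Φ.toContinuousLinearEquiv).IsAddHaarMeasure := inferInstance
  have h2 := Measure.isAddLeftInvariant_eq_smul (μ.map Φ.toContinuousLinearEquiv) ν
  refine ⟨(Measure.addHaarScalarFactor (μ.map Φ.toContinuousLinearEquiv) ν : NNReal), fun f hf => ?_⟩
  have h3 : ∫⁻ y, f y ∂(μ.map Φ.toContinuousLinearEquiv) = ∫⁻ x, f (Φ x) ∂μ :=
    lintegral_map hf Φ.toContinuousLinearEquiv.continuous.measurable
  have h4 := congrArg (fun m => ∫⁻ y, f y ∂m) h2
  simp only [lintegral_smul_measure, ENNReal.smul_def, smul_eq_mul] at h4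
  rw [← h3, h4]

lemma isAddHaarMeasure_volume_matrix (κ ι : Type*) [Fintype κ] [Fintype ι] :
    (volume : Measure (κ → ι → ℝ)).IsAddHaarMeasure := by
  have h : (volume : Measure (ι → ℝ)).IsAddHaarMeasure := inferInstance
  have h2 : SigmaFinite (volume : Measure (ι → ℝ)) := inferInstance
  exact @Measure.pi.isAddHaarMeasure κ (fun _ => ι → ℝ) _ _ (fun _ => volume)
    (fun _ => h2) _ _ (fun _ => h) _

lemma det_one_add_vecMulVec {ι : Type*} [Fintype ι] [DecidableEq ι] (t : ι → ℝ) :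
    (1 + Matrix.vecMulVec t t).det = 1 + ∑ a, t a ^ 2 := by
  have := Matrix.det_one_add_replicateCol_mul_replicateRow (ι := Unit) t t
  rw [← Matrix.vecMulVec_eq] at this
  rw [this]
  simp [dotProduct, sq]

lemma posDef_one_add_vecMulVec {ι : Type*} [Fintype ι] [DecidableEq ι] (t : ι → ℝ) :
    (1 + Matrix.vecMulVec t t).PosDef := by
  have h := Matrix.posSemidef_vecMulVec_self_star t
  simp only [star_trivial] at h
  exact Matrix.PosDef.one.add_posSemidef h

lemma posDef_one_add_transpose_mul {ι κ : Type*} [Fintype ι] [DecidableEq ι] [Fintype κ]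
    (c : Matrix κ ι ℝ) : (1 + c.transpose * c).PosDef := by
  have h := Matrix.posSemidef_conjTranspose_mul_self c
  rw [Matrix.conjTranspose_eq_transpose_of_trivial] at h
  exact Matrix.PosDef.one.add_posSemidef h

lemma sqrt_posDef_facts {ι : Type*} [Fintype ι] [DecidableEq ι] {A : Matrix ι ι ℝ}
    (hA : A.PosDef) :
    CFC.sqrt A * CFC.sqrt A = A ∧ (CFC.sqrt A).transpose = CFC.sqrt A ∧
      0 < (CFC.sqrt A).det ∧ (CFC.sqrt A).det = A.det ^ (1 / 2 : ℝ) := by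
  have h1 : CFC.sqrt A * CFC.sqrt A = A :=
    CFC.sqrt_mul_sqrt_self A hA.posSemidef.nonneg
  have h2 : (CFC.sqrt A).PosSemidef := Matrix.nonneg_iff_posSemidef.mp (CFC.sqrt_nonneg A)
  have h3 : (CFC.sqrt A).det * (CFC.sqrt A).det = A.det := by rw [← Matrix.det_mul, h1]
  have h4 : 0 ≤ (CFC.sqrt A).det := h2.det_nonneg
  have h5 := hA.det_pos
  refine ⟨h1, ?_, ?_, ?_⟩
  · have := h2.1
    rwa [Matrix.IsHermitian, Matrix.conjTranspose_eq_transpose_of_trivial] at this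
  · rcases h4.eq_or_lt with h | h
    · rw [← h] at h3; simp at h3; linarith
    · exact h
  · rw [← h3, ← Real.sqrt_eq_rpow, Real.sqrt_mul_self h4]

/-- The substitution `c ↦ (1 + t tᵀ) ^ (1/2) c`, with `c` a family of `|κ|` columns, in the integral
over all columns of a matrix but one. -/
lemma lintegral_det_add_vecMulVec {ι κ : Type*} [Fintype ι] [DecidableEq ι] [Fintype κ]
    (t : ι → ℝ) (e : ℝ) :
    ∫⁻ c : κ → ι → ℝ, ENNReal.ofReal
        ((1 + Matrix.vecMulVec t t + (Matrix.of c).transpose * Matrix.of c).det ^ e) =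
      ENNReal.ofReal ((1 + ∑ a, t a ^ 2) ^ (e + (Fintype.card κ : ℝ) / 2)) *
        ∫⁻ c : κ → ι → ℝ, ENNReal.ofReal
          ((1 + (Matrix.of c).transpose * Matrix.of c).det ^ e) := by
  obtain ⟨hL, hLt, hLd, hLe⟩ := sqrt_posDef_facts (posDef_one_add_vecMulVec t)
  set A := 1 + Matrix.vecMulVec t t with hA
  set L := CFC.sqrt A
  have hdet : A.det = 1 + ∑ a, t a ^ 2 := det_one_add_vecMulVec t
  have hApos : 0 < A.det := (posDef_one_add_vecMulVec t).det_pos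
  let f : (κ → ι → ℝ) →ₗ[ℝ] (κ → ι → ℝ) :=
    LinearMap.pi fun i => (Matrix.toLin' L) ∘ₗ LinearMap.proj i
  have hf : LinearMap.det f = L.det ^ Fintype.card κ := by
    simp only [f]
    rw [LinearMap.det_pi]
    simp [LinearMap.det_toLin']
  have hf0 : 0 < LinearMap.det f := by rw [hf]; positivity
  have hH := isAddHaarMeasure_volume_matrix κ ι
  have hmap := Measure.map_linearMap_addHaar_eq_smul_addHaar
    (volume : Measure (κ → ι → ℝ)) hf0.ne'
  have hcont : Continuous fun c : κ → ι → ℝ =>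
      (A + (Matrix.of c).transpose * Matrix.of c).det := by
    apply Continuous.matrix_det
    apply continuous_const.add
    apply Continuous.matrix_mul
    · apply Continuous.matrix_transpose; exact continuous_id
    · exact continuous_id
  have hmeas : Measurable fun c : κ → ι → ℝ => ENNReal.ofReal
        ((A + (Matrix.of c).transpose * Matrix.of c).det ^ e) :=
    (hcont.measurable.pow_const e).ennreal_ofReal
  have hfm : Measurable f := (LinearMap.continuous_of_finiteDimensional f).measurable
  have h1 := lintegral_map (μ := (volume : Measure (κ → ι → ℝ))) hmeas hfm
  rw [hmap, lintegral_smul_measure] at h1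
  have h2 : ∀ c : κ → ι → ℝ,
      (A + (Matrix.of (f c)).transpose * Matrix.of (f c)).det
        = A.det * (1 + (Matrix.of c).transpose * Matrix.of c).det := by
    intro c
    have : (Matrix.of (f c)) = Matrix.of c * L := by
      ext i a
      simp only [f, LinearMap.pi_apply, LinearMap.comp_apply, LinearMap.proj_apply,
        Matrix.toLin'_apply, Matrix.of_apply, Matrix.mulVec, dotProduct, Matrix.mul_apply]
      refine Finset.sum_congr rfl fun b _ => ?_
      have : L a b = L b a := congrFun (congrFun hLt.symm a) b
      rw [this]; ring
    rw [this, Matrix.transpose_mul, hLt]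
    have h3 : A + L * (Matrix.of c).transpose * (Matrix.of c * L)
        = L * (1 + (Matrix.of c).transpose * Matrix.of c) * L := by
      conv_lhs => rw [← hL]
      simp only [Matrix.mul_add, Matrix.add_mul, Matrix.mul_one, Matrix.mul_assoc]
    rw [h3, Matrix.det_mul, Matrix.det_mul, ← hL, Matrix.det_mul]
    ring
  have h3 : ∀ c : κ → ι → ℝ, ENNReal.ofReal
      ((A + (Matrix.of (f c)).transpose * Matrix.of (f c)).det ^ e) =
      ENNReal.ofReal (A.det ^ e) * ENNReal.ofReal
        ((1 + (Matrix.of c).transpose * Matrix.of c).det ^ e) := by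
    intro c
    have := (posDef_one_add_transpose_mul (Matrix.of c)).det_pos
    rw [h2, Real.mul_rpow hApos.le this.le, ENNReal.ofReal_mul (by positivity)]
  simp only [h3] at h1
  rw [lintegral_const_mul'] at h1
  swap
  · exact ENNReal.ofReal_ne_top
  have h4 : ENNReal.ofReal (LinearMap.det f) * ENNReal.ofReal |(LinearMap.det f)⁻¹| = 1 := by
    rw [← ENNReal.ofReal_mul hf0.le, abs_of_pos (by positivity), mul_inv_cancel₀ hf0.ne']
    simp
  have h5 := congrArg (fun x => ENNReal.ofReal (LinearMap.det f) * x) h1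
  simp only [smul_eq_mul] at h5
  rw [← mul_assoc, h4, one_mul, ← mul_assoc, ← ENNReal.ofReal_mul hf0.le] at h5
  rw [h5, hf, hLe, ← hdet]
  congr 2
  rw [← Real.rpow_natCast, ← Real.rpow_mul hApos.le, ← Real.rpow_add hApos]
  congr 1
  ring

/-- Singling out the column `j` of a matrix. -/
def columnSplit (ι : Type*) {m : Type*} [DecidableEq m] (j : m) :
    (ι → m → ℝ) ≃ₗ[ℝ] EuclideanSpace ℝ ι × ({i : m // i ≠ j} → ι → ℝ) where
  toFun T := (WithLp.toLp 2 fun a => T a j, fun i a => T a i)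
  map_add' _ _ := rfl
  map_smul' _ _ := rfl
  invFun p := fun a i => if h : i = j then p.1 a else p.2 ⟨i, h⟩ a
  left_inv T := by
    ext a i
    by_cases h : i = j
    · subst h; simp
    · simp [h]
  right_inv p := by
    ext
    · simp
    · rename_i i a
      simp [i.2]

/-- A column of a matrix with density proportional to `det (1 + T Tᵀ) ^ e` has density proportional
to `(1 + ‖t‖²) ^ (e + (|m| - 1) / 2)`. -/
lemma exists_lintegral_column {ι m : Type*} [Fintype ι] [DecidableEq ι] [Fintype m]
    [DecidableEq m] (j : m) (e : ℝ) :
    ∃ C : ENNReal, ∀ f : EuclideanSpace ℝ ι → ENNReal, Measurable f →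
      ∫⁻ T : ι → m → ℝ, f (WithLp.toLp 2 fun a => T a j) *
          ENNReal.ofReal ((1 + Matrix.of T * (Matrix.of T).transpose).det ^ e) =
        C * ∫⁻ t, f t * ENNReal.ofReal ((1 + ‖t‖ ^ 2) ^ (e + ((Fintype.card m : ℝ) - 1) / 2)) := by
  have hH := isAddHaarMeasure_volume_matrix ι m
  have hH' := isAddHaarMeasure_volume_matrix {i : m // i ≠ j} ι
  have hH2 : ((volume : Measure (EuclideanSpace ℝ ι)).prod
      (volume : Measure ({i : m // i ≠ j} → ι → ℝ))).IsAddHaarMeasure :=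
    Measure.prod.instIsAddHaarMeasure _ _
  obtain ⟨c, hc⟩ := exists_lintegral_comp_linearEquiv (volume : Measure (ι → m → ℝ))
    ((volume : Measure (EuclideanSpace ℝ ι)).prod
      (volume : Measure ({i : m // i ≠ j} → ι → ℝ))) (columnSplit ι j)
  refine ⟨c * ∫⁻ c : {i : m // i ≠ j} → ι → ℝ, ENNReal.ofReal
          ((1 + (Matrix.of c).transpose * Matrix.of c).det ^ e), fun f hf => ?_⟩
  let g : EuclideanSpace ℝ ι × ({i : m // i ≠ j} → ι → ℝ) → ENNReal := fun p =>
    f p.1 * ENNReal.ofReal ((1 + Matrix.vecMulVec (fun a => p.1 a) (fun a => p.1 a)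
      + (Matrix.of p.2).transpose * Matrix.of p.2).det ^ e)
  have hcont : Continuous fun p : EuclideanSpace ℝ ι × ({i : m // i ≠ j} → ι → ℝ) =>
      (1 + Matrix.vecMulVec (fun a => p.1 a) (fun a => p.1 a)
        + (Matrix.of p.2).transpose * Matrix.of p.2).det := by
    apply Continuous.matrix_det
    refine (continuous_const.add ?_).add ?_
    · refine continuous_pi fun a => continuous_pi fun b => ?_
      simp only [Matrix.vecMulVec_apply]
      fun_prop
    · apply Continuous.matrix_mul
      · apply Continuous.matrix_transpose; exact continuous_snd
      · exact continuous_snd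
  have hgm : Measurable g :=
    (hf.comp measurable_fst).mul (hcont.measurable.pow_const e).ennreal_ofReal
  have h1 : ∀ T : ι → m → ℝ, f (WithLp.toLp 2 fun a => T a j) *
      ENNReal.ofReal ((1 + Matrix.of T * (Matrix.of T).transpose).det ^ e) =
      g (columnSplit ι j T) := by
    intro T
    simp only [g, columnSplit]
    congr 4
    ext a b
    simp only [Matrix.add_apply, Matrix.mul_apply, Matrix.vecMulVec_apply, Matrix.of_apply,
      Matrix.transpose_apply]
    rw [Fintype.sum_eq_add_sum_subtype_ne _ j]
    exact (add_assoc _ _ _).symm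
  simp only [h1]
  rw [hc g hgm, lintegral_prod _ hgm.aemeasurable, mul_assoc]
  congr 1
  rw [← lintegral_const_mul]
  · refine lintegral_congr fun t => ?_
    simp only [g]
    have h2 : Measurable fun y : {i : m // i ≠ j} → ι → ℝ => ENNReal.ofReal
        ((1 + Matrix.vecMulVec (fun a => t a) (fun a => t a)
          + (Matrix.of y).transpose * Matrix.of y).det ^ e) :=
      ((hcont.comp (Continuous.prodMk_right t)).measurable.pow_const e).ennreal_ofReal
    rw [lintegral_const_mul _ h2, lintegral_det_add_vecMulVec]
    have h3 : ((Fintype.card {i : m // i ≠ j} : ℕ) : ℝ) = (Fintype.card m : ℝ) - 1 := by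
      have : 0 < Fintype.card m := Fintype.card_pos_iff.2 ⟨j⟩
      rw [Fintype.card_subtype_compl, Fintype.card_subtype_eq, Nat.cast_sub this]
      simp
    have h4 : ‖t‖ ^ 2 = ∑ a, t a ^ 2 := by
      rw [EuclideanSpace.norm_sq_eq]; simp
    rw [h3, h4]
    ring
  · exact hf.mul (((continuous_const.add (continuous_norm.pow 2)).measurable.pow_const
      _).ennreal_ofReal)

/-! ### The tail of the multivariate `t`-distribution -/

lemma two_pi_div_rpow_le_integral {q : ℕ} {N : ℝ} (hN : 0 < N)
    (hNi : Integrable fun t : EuclideanSpace ℝ (Fin q) => (1 + ‖t‖ ^ 2) ^ (-N / 2)) :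
    (2 * Real.pi / N) ^ ((q : ℝ) / 2) ≤
      ∫ t : EuclideanSpace ℝ (Fin q), (1 + ‖t‖ ^ 2) ^ (-N / 2) := by
  have h := GaussianFourier.integral_rexp_neg_mul_sq_norm (V := EuclideanSpace ℝ (Fin q))
    (b := N / 2) (by positivity)
  rw [finrank_euclideanSpace_fin] at h
  rw [show 2 * Real.pi / N = Real.pi / (N / 2) by field_simp, ← h]
  refine integral_mono_of_nonneg (ae_of_all _ fun t => (Real.exp_pos _).le) hNi
    (ae_of_all _ fun t => ?_)
  have hx : 0 ≤ ‖t‖ ^ 2 := by positivity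
  simp only
  rw [Real.rpow_def_of_pos (by linarith)]
  apply Real.exp_le_exp.2
  have := Real.log_le_sub_one_of_pos (show 0 < 1 + ‖t‖ ^ 2 by linarith)
  nlinarith

/-- The tail of the density `(1 + ‖t‖²) ^ (-N/2)` relative to its total mass. For `‖t‖² ≤ 1/2` the
density is below `exp (-2 N ‖t‖² / 5)`, half of whose exponent pays for the tail; the
rest of the range has an exponentially small share. -/
lemma exists_lintegral_tail_le {q : ℕ} (hq : 0 < q) :
    ∃ C : ℝ, 0 ≤ C ∧ ∀ N s : ℝ, 2 * q ≤ N → 0 ≤ s →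
      ∫⁻ t : EuclideanSpace ℝ (Fin q), Set.indicator {t | s ≤ ‖t‖ ^ 2} 1 t *
          ENNReal.ofReal ((1 + ‖t‖ ^ 2) ^ (-N / 2)) ≤
        ENNReal.ofReal (Real.exp ((q : ℝ) / 2 - s * N / 5) +
          C * N ^ ((q : ℝ) / 2) * (3 / 2 : ℝ) ^ (-(N / 2))) *
        ∫⁻ t : EuclideanSpace ℝ (Fin q), ENNReal.ofReal ((1 + ‖t‖ ^ 2) ^ (-N / 2)) := by
  set Cq := ∫ t : EuclideanSpace ℝ (Fin q), (1 + ‖t‖ ^ 2) ^ (-(2 * q : ℝ) / 2) with hCq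
  have hq' : (1 : ℝ) ≤ q := by exact_mod_cast hq
  have hCi : Integrable fun t : EuclideanSpace ℝ (Fin q) => (1 + ‖t‖ ^ 2) ^ (-(2 * q : ℝ) / 2) :=
    integrable_rpow_neg_one_add_norm_sq (by rw [finrank_euclideanSpace_fin]; linarith)
  have hC0 : 0 ≤ Cq := integral_nonneg fun t => by positivity
  refine ⟨Cq * (3 / 2 : ℝ) ^ (q : ℝ) * (2 * Real.pi) ^ (-((q : ℝ) / 2)), by positivity, ?_⟩
  intro N s hN hs
  have hN0 : 0 < N := by linarith
  have hNi : Integrable fun t : EuclideanSpace ℝ (Fin q) => (1 + ‖t‖ ^ 2) ^ (-N / 2) :=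
    integrable_rpow_neg_one_add_norm_sq (by rw [finrank_euclideanSpace_fin]; linarith)
  have hZ := two_pi_div_rpow_le_integral hN0 hNi
  set Z := ∫ t : EuclideanSpace ℝ (Fin q), (1 + ‖t‖ ^ 2) ^ (-N / 2) with hZdef
  have hG := GaussianFourier.integral_rexp_neg_mul_sq_norm (V := EuclideanSpace ℝ (Fin q))
    (b := N / 5) (by positivity)
  rw [finrank_euclideanSpace_fin] at hG
  have hGi : Integrable fun t : EuclideanSpace ℝ (Fin q) => Real.exp (-(N / 5) * ‖t‖ ^ 2) := by
    by_contra hcon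
    rw [integral_undef hcon] at hG
    have : 0 < (Real.pi / (N / 5)) ^ ((q : ℝ) / 2) := by positivity
    linarith
  -- the pointwise bound
  have hpt : ∀ t : EuclideanSpace ℝ (Fin q),
      Set.indicator {t | s ≤ ‖t‖ ^ 2} 1 t * ENNReal.ofReal ((1 + ‖t‖ ^ 2) ^ (-N / 2)) ≤
      ENNReal.ofReal (Real.exp (-(s * N / 5)) * Real.exp (-(N / 5) * ‖t‖ ^ 2) +
        (3 / 2 : ℝ) ^ (-(N / 2 - q)) * (1 + ‖t‖ ^ 2) ^ (-(2 * q : ℝ) / 2)) := by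
    intro t
    by_cases ht : s ≤ ‖t‖ ^ 2
    swap
    · rw [Set.indicator_of_notMem (by simpa using ht)]; simp
    rw [Set.indicator_of_mem (by simpa using ht)]
    simp only [Pi.one_apply, one_mul]
    apply ENNReal.ofReal_le_ofReal
    set x := ‖t‖ ^ 2 with hx
    have hx0 : 0 ≤ x := by positivity
    rcases le_total x (1 / 2) with h | h
    · have h1 : (1 + x) ^ (-N / 2) ≤ Real.exp (-(s * N / 5)) * Real.exp (-(N / 5) * x) := by
        rw [Real.rpow_def_of_pos (by linarith), ← Real.exp_add]
        apply Real.exp_le_exp.2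
        -- `log (1 + x) ≥ 4 x / 5` on `[0, 1/2]`
        have h2 := Real.le_log_one_add_of_nonneg hx0
        have h3 : 4 / 5 * x ≤ 2 * x / (x + 2) := by
          rw [le_div_iff₀ (by linarith)]; nlinarith
        nlinarith
      have : 0 ≤ (3 / 2 : ℝ) ^ (-(N / 2 - q)) * (1 + x) ^ (-(2 * q : ℝ) / 2) := by positivity
      linarith
    · have h1 : (1 + x) ^ (-N / 2) ≤
          (3 / 2 : ℝ) ^ (-(N / 2 - q)) * (1 + x) ^ (-(2 * q : ℝ) / 2) := by
        rw [show -N / 2 = -(N / 2 - q) + -(2 * q : ℝ) / 2 by ring,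
          Real.rpow_add (by linarith)]
        gcongr ?_ * _
        exact Real.rpow_le_rpow_of_nonpos (by norm_num) (by linarith) (by linarith)
      have : 0 ≤ Real.exp (-(s * N / 5)) * Real.exp (-(N / 5) * x) := by positivity
      linarith
  have hint := (hGi.const_mul (Real.exp (-(s * N / 5)))).add
    (hCi.const_mul ((3 / 2 : ℝ) ^ (-(N / 2 - q))))
  refine (lintegral_mono hpt).trans ?_
  rw [← ofReal_integral_eq_lintegral_ofReal hNi (ae_of_all _ fun t => by positivity),
    ← ENNReal.ofReal_mul (by positivity)]
  have h6 := ofReal_integral_eq_lintegral_ofReal hint (ae_of_all _ fun t => by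
    simp only [Pi.add_apply, Pi.zero_apply]; positivity)
  simp only [Pi.add_apply] at h6
  rw [← h6]
  apply ENNReal.ofReal_le_ofReal
  rw [integral_add (hGi.const_mul _) (hCi.const_mul _), integral_const_mul, integral_const_mul,
    hG, ← hCq, ← hZdef, add_mul]
  have hpi := Real.pi_pos
  refine add_le_add ?_ ?_
  · have h7 : (Real.pi / (N / 5)) ^ ((q : ℝ) / 2) ≤
        Real.exp ((q : ℝ) / 2) * (2 * Real.pi / N) ^ ((q : ℝ) / 2) := by
      rw [show Real.exp ((q : ℝ) / 2) = (Real.exp 1) ^ ((q : ℝ) / 2) by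
        rw [← Real.exp_mul, one_mul], ← Real.mul_rpow (Real.exp_pos _).le (by positivity)]
      apply Real.rpow_le_rpow (by positivity) _ (by positivity)
      -- halving the Gaussian exponent costs a factor `(5/2) ^ (q/2) ≤ exp (q/2)`
      have he : (5 / 2 : ℝ) ≤ Real.exp 1 := by have := Real.exp_one_gt_d9; linarith
      have : Real.pi / (N / 5) = 5 / 2 * (2 * Real.pi / N) := by field_simp
      rw [this]
      gcongr
    calc Real.exp (-(s * N / 5)) * (Real.pi / (N / 5)) ^ ((q : ℝ) / 2)
        ≤ Real.exp (-(s * N / 5)) *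
          (Real.exp ((q : ℝ) / 2) * (2 * Real.pi / N) ^ ((q : ℝ) / 2)) := by gcongr
      _ = Real.exp ((q : ℝ) / 2 - s * N / 5) * (2 * Real.pi / N) ^ ((q : ℝ) / 2) := by
          rw [← mul_assoc, ← Real.exp_add]; ring_nf
      _ ≤ _ := by gcongr
  · calc (3 / 2 : ℝ) ^ (-(N / 2 - q)) * Cq
        = (Cq * (3 / 2 : ℝ) ^ (q : ℝ) * (2 * Real.pi) ^ (-((q : ℝ) / 2)) * N ^ ((q : ℝ) / 2)
          * (3 / 2 : ℝ) ^ (-(N / 2))) * (2 * Real.pi / N) ^ ((q : ℝ) / 2) := by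
          rw [show -(N / 2 - q : ℝ) = q + -(N / 2) by ring, Real.rpow_add (by norm_num),
            Real.div_rpow (by positivity) hN0.le, Real.rpow_neg (by positivity : 0 ≤ 2 * Real.pi)]
          have h8 : (2 * Real.pi) ^ ((q : ℝ) / 2) ≠ 0 := by positivity
          have h9 : N ^ ((q : ℝ) / 2) ≠ 0 := by positivity
          field_simp
      _ ≤ _ := by gcongr

/-! ### Chi-squared tails -/

lemma integral_exp_mul_sq_gaussianReal {c : ℝ} (hc : c < 1 / 2) :
    ∫ x, Real.exp (c * x ^ 2) ∂(gaussianReal 0 1) = (1 - 2 * c) ^ (-(1 / 2 : ℝ)) ∧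
      Integrable (fun x => Real.exp (c * x ^ 2)) (gaussianReal 0 1) := by
  have h1 : ∫ x, Real.exp (c * x ^ 2) ∂(gaussianReal 0 1) = (1 - 2 * c) ^ (-(1 / 2 : ℝ)) := by
    rw [integral_gaussianReal_eq_integral_smul one_ne_zero]
    have h2 : ∀ x : ℝ, gaussianPDFReal 0 1 x • Real.exp (c * x ^ 2) =
        (Real.sqrt (2 * Real.pi))⁻¹ * Real.exp (-(1 / 2 - c) * x ^ 2) := by
      intro x
      simp only [gaussianPDFReal, NNReal.coe_one, mul_one, sub_zero, smul_eq_mul]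
      rw [mul_assoc, ← Real.exp_add]
      congr 2
      ring
    simp only [h2]
    rw [integral_const_mul, integral_gaussian, ← Real.sqrt_inv, ← Real.sqrt_mul (by positivity),
      Real.rpow_neg (by linarith), ← Real.sqrt_eq_rpow, ← Real.sqrt_inv]
    congr 1
    have := Real.pi_pos
    have h3 : 1 / 2 - c ≠ 0 := by linarith
    have h4 : 1 - 2 * c ≠ 0 := by linarith
    field_simp
  refine ⟨h1, ?_⟩
  by_contra hcon
  rw [integral_undef hcon] at h1
  have : 0 < (1 - 2 * c) ^ (-(1 / 2 : ℝ)) := Real.rpow_pos_of_pos (by linarith) _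
  linarith

lemma integral_exp_mul_norm_sq_stdGaussian {ι : Type*} [Fintype ι] {c : ℝ} (hc : c < 1 / 2) :
    ∫ x, Real.exp (c * ‖x‖ ^ 2) ∂(stdGaussian (EuclideanSpace ℝ ι)) =
        (1 - 2 * c) ^ (-((Fintype.card ι : ℝ) / 2)) ∧
      Integrable (fun x => Real.exp (c * ‖x‖ ^ 2)) (stdGaussian (EuclideanSpace ℝ ι)) := by
  have hm : AEMeasurable (WithLp.toLp 2) (Measure.pi fun _ : ι => gaussianReal 0 1) :=
    (by fun_prop : Measurable (WithLp.toLp 2 : (ι → ℝ) → EuclideanSpace ℝ ι)).aemeasurable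
  have hs : AEStronglyMeasurable (fun x => Real.exp (c * ‖x‖ ^ 2))
      (Measure.map (WithLp.toLp 2) (Measure.pi fun _ : ι => gaussianReal 0 1)) := by
    apply Continuous.aestronglyMeasurable; fun_prop
  have h1 : ∀ x : ι → ℝ, Real.exp (c * ‖(WithLp.toLp 2 x : EuclideanSpace ℝ ι)‖ ^ 2) =
      ∏ i, Real.exp (c * x i ^ 2) := by
    intro x
    rw [← Real.exp_sum, EuclideanSpace.norm_sq_eq, Finset.mul_sum]
    simp
  obtain ⟨h2, h3⟩ := integral_exp_mul_sq_gaussianReal hc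
  rw [← map_pi_eq_stdGaussian]
  constructor
  · rw [integral_map hm hs]
    simp only [h1]
    rw [integral_fintype_prod_eq_pow (ι := ι) (fun x : ℝ => Real.exp (c * x ^ 2)), h2,
      ← Real.rpow_natCast, ← Real.rpow_mul (by linarith)]
    congr 1
    ring
  · rw [integrable_map_measure hs hm]
    refine (Integrable.fintype_prod (μ := fun _ : ι => gaussianReal 0 1)
      (f := fun _ x => Real.exp (c * x ^ 2)) fun _ => h3).congr (ae_of_all _ fun x => ?_)
    simp only [Function.comp_apply, h1]

/-- The coordinates of a standard Gaussian vector along an orthonormal family are independent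
standard normal variables. -/
lemma map_inner_stdGaussian {E : Type*} [NormedAddCommGroup E] [InnerProductSpace ℝ E]
    [FiniteDimensional ℝ E] [MeasurableSpace E] [BorelSpace E] {ι : Type*} [Fintype ι]
    {b : ι → E} (hb : Orthonormal ℝ b) :
    (stdGaussian E).map (fun z => (WithLp.toLp 2 fun i => inner ℝ (b i) z : EuclideanSpace ℝ ι)) =
      stdGaussian (EuclideanSpace ℝ ι) := by
  have hm : Measurable
      (fun z : E => (WithLp.toLp 2 fun i => inner ℝ (b i) z : EuclideanSpace ℝ ι)) := by
    fun_prop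
  have : IsProbabilityMeasure ((stdGaussian E).map
      (fun z => (WithLp.toLp 2 fun i => inner ℝ (b i) z : EuclideanSpace ℝ ι))) :=
    Measure.isProbabilityMeasure_map hm.aemeasurable
  apply Measure.ext_of_charFun
  ext τ
  have h1 : charFun ((stdGaussian E).map
      (fun z => (WithLp.toLp 2 fun i => inner ℝ (b i) z : EuclideanSpace ℝ ι))) τ =
      charFun (stdGaussian E) (∑ i, τ i • b i) := by
    rw [charFun_apply, charFun_apply, integral_map hm.aemeasurable]
    · refine integral_congr_ae (ae_of_all _ fun z => ?_)
      simp only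
      congr 3
      rw [inner_sum, PiLp.inner_apply]
      refine Finset.sum_congr rfl fun i _ => ?_
      rw [real_inner_smul_right, real_inner_comm (b i) z]
      simp [mul_comm]
    · apply Continuous.aestronglyMeasurable; fun_prop
  rw [h1, charFun_stdGaussian, charFun_stdGaussian]
  have h2 : ‖∑ i, τ i • b i‖ ^ 2 = ‖τ‖ ^ 2 := by
    rw [← real_inner_self_eq_norm_sq, hb.inner_sum, EuclideanSpace.norm_sq_eq]
    simp [sq]
  have h3 : ((‖∑ i, τ i • b i‖ : ℝ) : ℂ) ^ 2 = ((‖τ‖ : ℝ) : ℂ) ^ 2 := by exact_mod_cast h2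
  rw [h3]

/-- The Chernoff bound for a chi-squared variable: the upper tail for `c > 0`, the lower one for
`c < 0`. -/
lemma stdGaussian_real_chiSq_le {E : Type*} [NormedAddCommGroup E] [InnerProductSpace ℝ E]
    [FiniteDimensional ℝ E] [MeasurableSpace E] [BorelSpace E] {ι : Type*} [Fintype ι]
    {b : ι → E} (hb : Orthonormal ℝ b) {c : ℝ} (hc : c < 1 / 2) (x : ℝ) :
    (stdGaussian E).real {z | c * x ≤ c * ∑ i, inner ℝ (b i) z ^ 2} ≤
      Real.exp (-(c * x)) * (1 - 2 * c) ^ (-((Fintype.card ι : ℝ) / 2)) := by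
  have hm : Measurable
      (fun z : E => (WithLp.toLp 2 fun i => inner ℝ (b i) z : EuclideanSpace ℝ ι)) := by
    fun_prop
  obtain ⟨h1, h2⟩ := integral_exp_mul_norm_sq_stdGaussian (ι := ι) hc
  have h3 := mul_meas_ge_le_integral_of_nonneg
    (ae_of_all (stdGaussian (EuclideanSpace ℝ ι)) fun x => (Real.exp_pos (c * ‖x‖ ^ 2)).le) h2
    (Real.exp (c * x))
  rw [h1, ← map_inner_stdGaussian hb, map_measureReal_apply hm (by
    apply measurableSet_le measurable_const; fun_prop)] at h3
  have h4 : {z : E | c * x ≤ c * ∑ i, inner ℝ (b i) z ^ 2} =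
      (fun z : E => (WithLp.toLp 2 fun i => inner ℝ (b i) z : EuclideanSpace ℝ ι)) ⁻¹'
        {y | Real.exp (c * x) ≤ Real.exp (c * ‖y‖ ^ 2)} := by
    ext z
    simp [EuclideanSpace.norm_sq_eq]
  rw [h4, Real.exp_neg, ← div_eq_inv_mul, le_div_iff₀ (Real.exp_pos _), mul_comm]
  exact h3

/-! ### The sampling model in terms of a standard Gaussian matrix -/

/-- The `q × n` matrices, as `n` columns, with the Frobenius inner product. -/
abbrev Noise (q n : ℕ) : Type := PiLp 2 fun _ : Fin n => EuclideanSpace ℝ (Fin q)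

lemma map_ofLp_stdGaussian (q n : ℕ) :
    (stdGaussian (Noise q n)).map WithLp.ofLp =
      Measure.pi fun _ : Fin n => stdGaussian (EuclideanSpace ℝ (Fin q)) := by
  have h : (Measure.pi fun _ : Fin n => stdGaussian (EuclideanSpace ℝ (Fin q))).map
      (WithLp.toLp 2) = stdGaussian (Noise q n) := by
    have : IsProbabilityMeasure ((Measure.pi fun _ : Fin n =>
        stdGaussian (EuclideanSpace ℝ (Fin q))).map (WithLp.toLp 2)) :=
      Measure.isProbabilityMeasure_map (by fun_prop)
    apply Measure.ext_of_charFun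
    ext t
    rw [charFun_pi, charFun_stdGaussian]
    simp only [charFun_stdGaussian]
    rw [← Complex.exp_sum]
    congr 1
    have := PiLp.norm_sq_eq_of_L2 (fun _ : Fin n => EuclideanSpace ℝ (Fin q)) t
    rw [← Finset.sum_div, Finset.sum_neg_distrib]
    congr 2
    exact_mod_cast this.symm
  rw [← h, Measure.map_map (by fun_prop) (by fun_prop)]
  simp [Function.comp_def]

/-- The data `μ + V ^ (1/2) Z` with noise matrix `Z`. -/
def sample {q n : ℕ} (μ : Matrix (Fin q) (Fin n) ℝ) (V : Matrix (Fin q) (Fin q) ℝ)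
    (z : Noise q n) : Fin n → EuclideanSpace ℝ (Fin q) :=
  fun i => WithLp.toLp 2 (fun a => μ a i) +
    Matrix.toEuclideanCLM (n := Fin q) (𝕜 := ℝ) (CFC.sqrt V) (z i)

lemma matrixNormal_eq_map {q n : ℕ} (μ : Matrix (Fin q) (Fin n) ℝ)
    (V : Matrix (Fin q) (Fin q) ℝ) :
    matrixNormal μ V = (stdGaussian (Noise q n)).map (sample μ V) := by
  have h : sample μ V = (fun x i => WithLp.toLp 2 (fun a => μ a i) +
    Matrix.toEuclideanCLM (n := Fin q) (𝕜 := ℝ) (CFC.sqrt V) (x i)) ∘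
      (WithLp.ofLp : Noise q n → _) := rfl
  have h2 := Measure.pi_map_pi (μ := fun _ : Fin n => stdGaussian (EuclideanSpace ℝ (Fin q)))
    (f := fun i x => WithLp.toLp 2 (fun a => μ a i) +
      Matrix.toEuclideanCLM (n := Fin q) (𝕜 := ℝ) (CFC.sqrt V) x) (fun i => by fun_prop)
  rw [h, ← Measure.map_map (by fun_prop) (by fun_prop), map_ofLp_stdGaussian]
  exact h2.symm

/-- The rank one matrix `v wᵀ`; its inner product with `Z` is `vᵀ Z w`. -/
def tensor {q n : ℕ} (w : EuclideanSpace ℝ (Fin n)) (v : EuclideanSpace ℝ (Fin q)) : Noise q n :=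
  WithLp.toLp 2 fun l => w l • v

lemma inner_tensor_tensor {q n : ℕ} (w w' : EuclideanSpace ℝ (Fin n))
    (v v' : EuclideanSpace ℝ (Fin q)) :
    inner ℝ (tensor w v) (tensor w' v') = inner ℝ w w' * inner ℝ v v' := by
  rw [tensor, tensor, PiLp.inner_apply, PiLp.inner_apply w w', Finset.sum_mul]
  refine Finset.sum_congr rfl fun i _ => ?_
  simp only [real_inner_smul_left, real_inner_smul_right]
  simp
  ring

lemma orthonormal_tensor_left {q n : ℕ} {κ : Type*} {w : κ → EuclideanSpace ℝ (Fin n)}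
    (hw : Orthonormal ℝ w) {v : EuclideanSpace ℝ (Fin q)} (hv : ‖v‖ = 1) :
    Orthonormal ℝ fun i => tensor (w i) v := by
  classical
  rw [orthonormal_iff_ite] at hw ⊢
  intro i j
  rw [inner_tensor_tensor, hw, real_inner_self_eq_norm_sq, hv]
  simp

lemma orthonormal_tensor_right {q n : ℕ} {κ : Type*} {v : κ → EuclideanSpace ℝ (Fin q)}
    (hv : Orthonormal ℝ v) {w : EuclideanSpace ℝ (Fin n)} (hw : ‖w‖ = 1) :
    Orthonormal ℝ fun i => tensor w (v i) := by
  classical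
  rw [orthonormal_iff_ite] at hv ⊢
  intro i j
  rw [inner_tensor_tensor, hv, real_inner_self_eq_norm_sq, hw]
  simp

/-! ### Tail of a projected matrix `t`-distribution -/

/-- The linear substitution `D ↦ R D C` on matrices. -/
def sandwich {ι κ : Type*} [Fintype ι] [DecidableEq ι] [Fintype κ] [DecidableEq κ]
    {R : Matrix ι ι ℝ} {C : Matrix κ κ ℝ} (hR : IsUnit R.det) (hC : IsUnit C.det) :
    (ι → κ → ℝ) ≃ₗ[ℝ] (ι → κ → ℝ) where
  toFun D := R * Matrix.of D * C
  map_add' D D' := by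
    change R * (Matrix.of D + Matrix.of D') * C = R * Matrix.of D * C + R * Matrix.of D' * C
    rw [Matrix.mul_add, Matrix.add_mul]
  map_smul' c D := by
    change R * (c • Matrix.of D) * C = c • (R * Matrix.of D * C)
    rw [Matrix.mul_smul, Matrix.smul_mul]
  invFun D := R⁻¹ * Matrix.of D * C⁻¹
  left_inv D := by
    change R⁻¹ * (R * Matrix.of D * C) * C⁻¹ = Matrix.of D
    rw [← Matrix.mul_assoc, ← Matrix.mul_assoc, Matrix.nonsing_inv_mul _ hR, Matrix.one_mul,
      Matrix.mul_assoc, Matrix.mul_nonsing_inv _ hC, Matrix.mul_one]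
  right_inv D := by
    change R * (R⁻¹ * Matrix.of D * C⁻¹) * C = Matrix.of D
    rw [← Matrix.mul_assoc, ← Matrix.mul_assoc, Matrix.mul_nonsing_inv _ hR, Matrix.one_mul,
      Matrix.mul_assoc, Matrix.nonsing_inv_mul _ hC, Matrix.mul_one]

lemma matrixT_univ_le {ι κ : Type*} [Fintype ι] [Fintype κ] [DecidableEq ι] [DecidableEq κ]
    (ν : ℝ) (μ : Matrix ι κ ℝ) (S : Matrix ι ι ℝ) (Ω : Matrix κ κ ℝ) :
    matrixT ν μ S Ω Set.univ ≤ 1 := by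
  rw [matrixT, Measure.smul_apply, withDensity_apply _ MeasurableSet.univ, smul_eq_mul,
    Measure.restrict_univ]
  exact ENNReal.inv_mul_le_one _

/-- After standardization, a column of the matrix `t`-distribution has the tail of the multivariate
`t`-distribution with density proportional to `(1 + ‖t‖²) ^ (-(ν + |ι|) / 2)`. -/
lemma matrixT_tail_le {q : ℕ} {κ : Type*} [Fintype κ] [DecidableEq κ]
    {ν : ℝ} {μ : Matrix (Fin q) κ ℝ} {S R : Matrix (Fin q) (Fin q) ℝ} {Ω C : Matrix κ κ ℝ}
    (hRR : R * R = S⁻¹) (hRt : R.transpose = R) (hR : IsUnit R.det)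
    (hCC : C * C.transpose = Ω⁻¹) (hC : IsUnit C.det) (j : κ) (s δ : ℝ)
    (htail : ∫⁻ t : EuclideanSpace ℝ (Fin q), Set.indicator {t | s ≤ ‖t‖ ^ 2} 1 t *
          ENNReal.ofReal ((1 + ‖t‖ ^ 2) ^ (-(ν + q) / 2)) ≤
        ENNReal.ofReal δ *
        ∫⁻ t : EuclideanSpace ℝ (Fin q), ENNReal.ofReal ((1 + ‖t‖ ^ 2) ^ (-(ν + q) / 2))) :
    matrixT ν μ S Ω {T | s ≤ ∑ a, (R * (Matrix.of T - μ) * C) a j ^ 2} ≤ ENNReal.ofReal δ := by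
  have hH := isAddHaarMeasure_volume_matrix (Fin q) κ
  set e : ℝ := -(ν + (Fintype.card (Fin q) : ℝ) + (Fintype.card κ : ℝ) - 1) / 2 with he
  obtain ⟨c₁, hc₁⟩ := exists_lintegral_comp_linearEquiv (volume : Measure (Fin q → κ → ℝ))
    (volume : Measure (Fin q → κ → ℝ)) (sandwich hR hC)
  obtain ⟨c₂, hc₂⟩ := exists_lintegral_column (ι := Fin q) j e
  have hK : ∀ T : Fin q → κ → ℝ, matrixTKernel ν μ S Ω (Matrix.of T) =
      (1 + Matrix.of (sandwich hR hC (T - fun a i => μ a i)) *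
        (Matrix.of (sandwich hR hC (T - fun a i => μ a i))).transpose).det ^ e := by
    intro T
    rw [matrixTKernel, ← he]
    congr 1
    have h1 : Matrix.of (sandwich hR hC (T - fun a i => μ a i)) =
      R * (Matrix.of T - μ) * C := rfl
    rw [h1, Matrix.transpose_mul, Matrix.transpose_mul, hRt, ← hRR, ← hCC]
    rw [show R * R * (Matrix.of T - μ) * (C * C.transpose) * (Matrix.of T - μ).transpose =
      R * (R * (Matrix.of T - μ) * (C * C.transpose) * (Matrix.of T - μ).transpose) by
        simp only [Matrix.mul_assoc], Matrix.det_one_add_mul_comm]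
    simp only [Matrix.mul_assoc]
  have hcont : Continuous fun T : Fin q → κ → ℝ =>
      (1 + Matrix.of T * (Matrix.of T).transpose).det := by
    apply Continuous.matrix_det
    apply continuous_const.add
    apply Continuous.matrix_mul
    · exact continuous_id
    · apply Continuous.matrix_transpose; exact continuous_id
  -- all integrals of functions of the `j`-th standardized column reduce to integrals over `ℝ^q`
  have key : ∀ f : EuclideanSpace ℝ (Fin q) → ENNReal, Measurable f →
      ∫⁻ T : Fin q → κ → ℝ,
        f (WithLp.toLp 2 fun a => (R * (Matrix.of T - μ) * C) a j) *
          ENNReal.ofReal (matrixTKernel ν μ S Ω (Matrix.of T)) =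
      c₁ * c₂ * ∫⁻ t, f t * ENNReal.ofReal ((1 + ‖t‖ ^ 2) ^ (-(ν + q) / 2)) := by
    intro f hf
    let g : (Fin q → κ → ℝ) → ENNReal := fun T => f (WithLp.toLp 2 fun a => T a j) *
      ENNReal.ofReal ((1 + Matrix.of T * (Matrix.of T).transpose).det ^ e)
    have hg : Measurable g :=
      (hf.comp (by fun_prop)).mul (hcont.measurable.pow_const e).ennreal_ofReal
    have h1 : ∀ T : Fin q → κ → ℝ,
        f (WithLp.toLp 2 fun a => (R * (Matrix.of T - μ) * C) a j) *
          ENNReal.ofReal (matrixTKernel ν μ S Ω (Matrix.of T)) =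
        g (sandwich hR hC (T - fun a i => μ a i)) := by
      intro T
      rw [hK]
      rfl
    simp only [h1]
    rw [lintegral_sub_right_eq_self (fun T => g (sandwich hR hC T)) (fun a i => μ a i), hc₁ g hg,
      hc₂ f hf, mul_assoc]
    congr 5
    ext t
    congr 3
    simp [he]
    ring
  have hKm : Measurable fun T : Fin q → κ → ℝ =>
      ENNReal.ofReal (matrixTKernel ν μ S Ω (Matrix.of T)) := by
    simp only [hK]
    refine Measurable.ennreal_ofReal (Measurable.pow_const ?_ e)
    exact hcont.measurable.comp
      ((LinearMap.continuous_of_finiteDimensional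
        (sandwich hR hC).toLinearMap).measurable.comp (measurable_id.sub_const _))
  have hcol : Measurable fun T : Fin q → κ → ℝ =>
      ∑ a, (R * (Matrix.of T - μ) * C) a j ^ 2 := by
    refine Finset.measurable_sum _ fun a _ => Measurable.pow_const ?_ 2
    have h1 : Measurable fun T : Fin q → κ → ℝ => sandwich hR hC (T - fun a i => μ a i) :=
      (LinearMap.continuous_of_finiteDimensional
        (sandwich hR hC).toLinearMap).measurable.comp (measurable_id.sub_const _)
    exact (measurable_pi_apply j).comp ((measurable_pi_apply a).comp h1)
  have hE : MeasurableSet {T : Fin q → κ → ℝ | s ≤ ∑ a, (R * (Matrix.of T - μ) * C) a j ^ 2} :=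
    measurableSet_le measurable_const hcol
  have hball : MeasurableSet {t : EuclideanSpace ℝ (Fin q) | s ≤ ‖t‖ ^ 2} :=
    measurableSet_le measurable_const (by fun_prop)
  have hnum : ∫⁻ T in {T : Fin q → κ → ℝ | s ≤ ∑ a, (R * (Matrix.of T - μ) * C) a j ^ 2},
      ENNReal.ofReal (matrixTKernel ν μ S Ω (Matrix.of T)) =
      c₁ * c₂ * ∫⁻ t, Set.indicator {t : EuclideanSpace ℝ (Fin q) | s ≤ ‖t‖ ^ 2} 1 t *
        ENNReal.ofReal ((1 + ‖t‖ ^ 2) ^ (-(ν + q) / 2)) := by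
    rw [← key _ (measurable_one.indicator hball), ← lintegral_indicator hE]
    refine lintegral_congr fun T => ?_
    by_cases hT : s ≤ ∑ a, (R * (Matrix.of T - μ) * C) a j ^ 2
    · rw [Set.indicator_of_mem (by exact hT), Set.indicator_of_mem]
      · simp
      · simpa [EuclideanSpace.norm_sq_eq] using hT
    · rw [Set.indicator_of_notMem (by exact hT), Set.indicator_of_notMem]
      · simp
      · simpa [EuclideanSpace.norm_sq_eq] using hT
  have hden := key (fun _ => 1) measurable_const
  simp only [one_mul] at hden
  rw [matrixT, Measure.smul_apply, withDensity_apply _ hE, smul_eq_mul, hnum, hden]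
  -- `x⁻¹ * x ≤ 1` holds in `ℝ≥0∞` for every `x`, so finiteness of the constants is not needed
  calc _ ≤ (c₁ * c₂ * ∫⁻ t : EuclideanSpace ℝ (Fin q),
            ENNReal.ofReal ((1 + ‖t‖ ^ 2) ^ (-(ν + q) / 2)))⁻¹ *
          (c₁ * c₂ * (ENNReal.ofReal δ * ∫⁻ t : EuclideanSpace ℝ (Fin q),
            ENNReal.ofReal ((1 + ‖t‖ ^ 2) ^ (-(ν + q) / 2)))) := by gcongr
    _ = ENNReal.ofReal δ * ((c₁ * c₂ * ∫⁻ t : EuclideanSpace ℝ (Fin q),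
            ENNReal.ofReal ((1 + ‖t‖ ^ 2) ^ (-(ν + q) / 2)))⁻¹ *
          (c₁ * c₂ * ∫⁻ t : EuclideanSpace ℝ (Fin q),
            ENNReal.ofReal ((1 + ‖t‖ ^ 2) ^ (-(ν + q) / 2)))) := by ring
    _ ≤ ENNReal.ofReal δ * 1 := by
        gcongr
        exact ENNReal.inv_mul_le_one _
    _ = ENNReal.ofReal δ := mul_one _

/-! ### Dropping one predictor -/

/-- A row of the design matrix, as a Euclidean vector. -/
abbrev rowVec {p n : ℕ} (X : Matrix (Fin p) (Fin n) ℝ) (j : Fin p) : EuclideanSpace ℝ (Fin n) :=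
  WithLp.toLp 2 (X j)

/-- The row space of `X_M`. -/
abbrev rowSpace {p n : ℕ} (X : Matrix (Fin p) (Fin n) ℝ) (M : Finset (Fin p)) :
    Submodule ℝ (EuclideanSpace ℝ (Fin n)) :=
  Submodule.span ℝ (Set.range fun j : M => rowVec X j)

/-- The component of the predictor `j` orthogonal to the other predictors of `M`. -/
def dropResidual {p n : ℕ} (X : Matrix (Fin p) (Fin n) ℝ) (M : Finset (Fin p)) (j : Fin p) :
    EuclideanSpace ℝ (Fin n) :=
  rowVec X j - (rowSpace X (M.erase j)).starProjection (rowVec X j)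

/-- The direction of `dropResidual`. -/
def dropDirection {p n : ℕ} (X : Matrix (Fin p) (Fin n) ℝ) (M : Finset (Fin p)) (j : Fin p) :
    EuclideanSpace ℝ (Fin n) :=
  ‖dropResidual X M j‖⁻¹ • dropResidual X M j

section

variable {p q n : ℕ} {X : Matrix (Fin p) (Fin n) ℝ} {Y : Matrix (Fin q) (Fin n) ℝ}
  {M : Finset (Fin p)} {j : Fin p}

lemma hatMatrix_mulVec (v : EuclideanSpace ℝ (Fin n)) :
    (hatMatrix X M).mulVec v.ofLp = ((rowSpace X M).starProjection v).ofLp := by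
  rw [← Matrix.ofLp_toEuclideanCLM, hatMatrix]
  simp

lemma rowVec_mem_rowSpace (hj : j ∈ M) : rowVec X j ∈ rowSpace X M :=
  Submodule.subset_span ⟨⟨j, hj⟩, rfl⟩

lemma rowSpace_mono {M' : Finset (Fin p)} (h : M ⊆ M') : rowSpace X M ≤ rowSpace X M' := by
  apply Submodule.span_mono
  rintro _ ⟨i, rfl⟩
  exact ⟨⟨i, h i.2⟩, rfl⟩

/-- Absorbing the predictor `j` into the others leaves the residual `b_j r_jᵀ`. -/
lemma exists_sparser_sub_eq (hj : j ∈ M) (BM : Matrix (Fin q) M ℝ) :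
    ∃ B ∈ sparser q M, BM * rowsOf X M - B * X =
      Matrix.vecMulVec (fun a => BM a ⟨j, hj⟩) (dropResidual X M j).ofLp := by
  obtain ⟨c, hc⟩ := (Submodule.mem_span_range_iff_exists_fun ℝ).1
    ((rowSpace X (M.erase j)).starProjection_apply_mem (rowVec X j))
  let c' : Fin p → ℝ := fun i => if h : i ∈ M.erase j then c ⟨i, h⟩ else 0
  let bm : Fin q → Fin p → ℝ := fun a i => if h : i ∈ M then BM a ⟨i, h⟩ else 0
  let B : Matrix (Fin q) (Fin p) ℝ := fun a i =>
    if i ∈ M.erase j then bm a i + BM a ⟨j, hj⟩ * c' i else 0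
  refine ⟨B, ?_, ?_⟩
  · have h1 : {i : Fin p | (fun a => B a i) ≠ 0} ⊆ (M.erase j : Finset (Fin p)) := by
      intro i hi
      by_contra h
      apply hi
      ext a
      have h' : i ∉ M.erase j := h
      simp only [B, if_neg h', Pi.zero_apply]
    have h2 := Set.ncard_le_ncard h1 (Finset.finite_toSet _)
    rw [Set.ncard_coe_finset, Finset.card_erase_of_mem hj] at h2
    have h3 : 0 < M.card := Finset.card_pos.2 ⟨j, hj⟩
    simp only [sparser, Set.mem_ofPred_eq]
    omega
  · ext a l
    have h1 : (BM * rowsOf X M) a l = BM a ⟨j, hj⟩ * X j l + ∑ i ∈ M.erase j, bm a i * X i l := by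
      rw [Matrix.mul_apply]
      have : ∀ i : M, BM a i * rowsOf X M i l = bm a i * X i l := by
        intro i
        simp [bm, rowsOf]
      simp only [this]
      rw [Finset.sum_coe_sort M (fun i => bm a i * X i l), ← Finset.add_sum_erase M _ hj]
      simp [bm, hj]
    have h2 : (B * X) a l = ∑ i ∈ M.erase j, (bm a i + BM a ⟨j, hj⟩ * c' i) * X i l := by
      rw [Matrix.mul_apply]
      have h3 : ∀ i, B a i * X i l =
          if i ∈ M.erase j then (bm a i + BM a ⟨j, hj⟩ * c' i) * X i l else 0 := by
        intro i
        simp only [B]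
        split_ifs <;> simp
      rw [Finset.sum_congr rfl fun i _ => h3 i]
      rw [Finset.sum_ite_mem, Finset.univ_inter]
    have h4 : (dropResidual X M j).ofLp l = X j l - ∑ i ∈ M.erase j, c' i * X i l := by
      have h5 : ∀ i : M.erase j, c' i = c i := fun i => dif_pos i.2
      rw [dropResidual, ← hc, ← Finset.sum_coe_sort (M.erase j) (fun i => c' i * X i l)]
      simp only [h5]
      simp
    rw [Matrix.sub_apply, h1, h2, Matrix.vecMulVec_apply, h4, mul_sub, Finset.mul_sum]
    simp only [add_mul, Finset.sum_add_distrib, mul_assoc]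
    ring

lemma objective_eq_of_sub_eq {BM : Matrix (Fin q) M ℝ} {B : Matrix (Fin q) (Fin p) ℝ}
    {b : Fin q → ℝ} {r : EuclideanSpace ℝ (Fin n)}
    (h : BM * rowsOf X M - B * X = Matrix.vecMulVec b r.ofLp) :
    objective X Y M BM B =
      (∑ a, ((invSqrt (sigmaHat X Y M)).mulVec b a) ^ 2) * ‖r‖ ^ 2 := by
  rw [objective, h, frobSq, Matrix.mul_vecMulVec, EuclideanSpace.norm_sq_eq, Finset.sum_mul_sum]
  simp [Matrix.vecMulVec_apply, mul_pow]

lemma Admissible.two_mul_le {ε : ℝ} {BM : Matrix (Fin q) M ℝ} (h : Admissible X Y ε M BM)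
    (hj : j ∈ M) :
    2 * ε ≤ (∑ a, ((invSqrt (sigmaHat X Y M)).mulVec (fun a => BM a ⟨j, hj⟩) a) ^ 2) *
      ‖dropResidual X M j‖ ^ 2 := by
  obtain ⟨⟨Bmin, -, hmin, hε⟩, -⟩ := h
  obtain ⟨B, hB, hBX⟩ := exists_sparser_sub_eq (X := X) hj BM
  rw [← objective_eq_of_sub_eq hBX]
  have := hmin hB
  simp only [Set.mem_ofPred_eq] at this
  linarith

lemma linearIndependent_of_dropResidual_ne_zero
    (h : ∀ i ∈ M, dropResidual X M i ≠ 0) : LinearIndependent ℝ fun i : M => rowVec X i := by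
  rw [linearIndependent_iff_notMem_span]
  intro i hi
  apply h i i.2
  rw [dropResidual, sub_eq_zero, eq_comm, Submodule.starProjection_eq_self_iff]
  refine Submodule.span_mono ?_ hi
  rintro _ ⟨k, hk, rfl⟩
  refine ⟨⟨k, Finset.mem_erase.2 ⟨?_, k.2⟩⟩, rfl⟩
  intro hki
  exact hk.2 (Subtype.ext hki)

lemma posDef_rowsOf_mul_transpose (h : LinearIndependent ℝ fun i : M => rowVec X i) :
    (rowsOf X M * (rowsOf X M).transpose).PosDef := by
  have h1 : LinearIndependent ℝ (rowsOf X M).row := by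
    have := h.map' (WithLp.linearEquiv 2 ℝ (Fin n → ℝ)).toLinearMap (LinearEquiv.ker _)
    exact this
  have h2 := Matrix.PosDef.mul_conjTranspose_self _ (Matrix.vecMul_injective_iff.2 h1)
  rwa [Matrix.conjTranspose_eq_transpose_of_trivial] at h2

lemma inner_dropResidual_of_mem {x : EuclideanSpace ℝ (Fin n)}
    (hx : x ∈ rowSpace X (M.erase j)) : inner ℝ (dropResidual X M j) x = 0 :=
  Submodule.starProjection_inner_eq_zero _ _ hx

lemma norm_dropDirection (h : dropResidual X M j ≠ 0) : ‖dropDirection X M j‖ = 1 := by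
  rw [dropDirection, norm_smul, norm_inv, norm_norm, inv_mul_cancel₀ (norm_ne_zero_iff.2 h)]

lemma inner_dropDirection_of_mem {x : EuclideanSpace ℝ (Fin n)}
    (hx : x ∈ rowSpace X (M.erase j)) : inner ℝ (dropDirection X M j) x = 0 := by
  rw [dropDirection, real_inner_smul_left, inner_dropResidual_of_mem hx, mul_zero]

lemma dropDirection_mem (hj : j ∈ M) : dropDirection X M j ∈ rowSpace X M :=
  Submodule.smul_mem _ _ (Submodule.sub_mem _ (rowVec_mem_rowSpace hj)
    (rowSpace_mono (Finset.erase_subset j M) (Submodule.starProjection_apply_mem _ _)))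

lemma inner_dropDirection_rowVec :
    inner ℝ (dropDirection X M j) (rowVec X j) = ‖dropResidual X M j‖ := by
  have h1 : inner ℝ (dropResidual X M j) (rowVec X j) = ‖dropResidual X M j‖ ^ 2 := by
    have h2 : rowVec X j = dropResidual X M j +
        (rowSpace X (M.erase j)).starProjection (rowVec X j) := by
      rw [dropResidual]; abel
    conv_lhs => rw [h2]
    rw [inner_add_right, inner_dropResidual_of_mem (Submodule.starProjection_apply_mem _ _),
      real_inner_self_eq_norm_sq, add_zero]
  rw [dropDirection, real_inner_smul_left, h1]
  rcases eq_or_ne ‖dropResidual X M j‖ 0 with h | h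
  · simp [h]
  · field_simp

lemma inner_dropDirection_rowVec_of_ne {i : Fin p} (hi : i ∈ M) (hij : i ≠ j) :
    inner ℝ (dropDirection X M j) (rowVec X i) = 0 :=
  inner_dropDirection_of_mem (rowVec_mem_rowSpace (Finset.mem_erase.2 ⟨hij, hi⟩))

lemma rowsOf_mulVec_dropDirection (hj : j ∈ M) :
    (rowsOf X M).mulVec (dropDirection X M j).ofLp =
      Pi.single ⟨j, hj⟩ ‖dropResidual X M j‖ := by
  ext i
  have h1 : (rowsOf X M).mulVec (dropDirection X M j).ofLp i =
      inner ℝ (dropDirection X M j) (rowVec X i) := by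
    simp [Matrix.mulVec, dotProduct, rowsOf, PiLp.inner_apply]
  rw [h1]
  by_cases h : (i : Fin p) = j
  · have : i = ⟨j, hj⟩ := Subtype.ext h
    subst this
    rw [Pi.single_eq_same, inner_dropDirection_rowVec]
  · rw [inner_dropDirection_rowVec_of_ne i.2 h, Pi.single_eq_of_ne]
    intro h2
    exact h (congrArg Subtype.val h2)

/-- In the direction `u_j` the fitted values `B̂_M X_M` agree with the data. -/
lemma norm_mul_bHat (h : LinearIndependent ℝ fun i : M => rowVec X i) (hj : j ∈ M) (a : Fin q) :
    ‖dropResidual X M j‖ * bHat X Y M a ⟨j, hj⟩ = Y.mulVec (dropDirection X M j).ofLp a := by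
  obtain ⟨c, hc⟩ := (Submodule.mem_span_range_iff_exists_fun ℝ).1 (dropDirection_mem (X := X) hj)
  have hc' : (dropDirection X M j).ofLp = (rowsOf X M).transpose.mulVec c := by
    rw [← hc]
    ext l
    simp [Matrix.mulVec, dotProduct, rowsOf, mul_comm]
  have hG : IsUnit (rowsOf X M * (rowsOf X M).transpose).det :=
    (posDef_rowsOf_mul_transpose h).det_pos.ne'.isUnit
  have h1 : (bHat X Y M).mulVec ((rowsOf X M).mulVec (dropDirection X M j).ofLp) =
      Y.mulVec (dropDirection X M j).ofLp := by
    rw [hc', Matrix.mulVec_mulVec, Matrix.mulVec_mulVec, Matrix.mulVec_mulVec, bHat,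
      Matrix.mul_assoc _ (rowsOf X M) _, Matrix.nonsing_inv_mul_cancel_right _ _ hG]
  rw [← h1, rowsOf_mulVec_dropDirection hj]
  simp [mul_comm]

/-- A factorization `X_M X_Mᵀ = C Cᵀ` by an orthonormal basis of the row space that contains the
direction `u_j`. -/
lemma exists_gram_factor (h : LinearIndependent ℝ fun i : M => rowVec X i) (hj : j ∈ M) :
    ∃ C : Matrix M M ℝ, C * C.transpose = rowsOf X M * (rowsOf X M).transpose ∧
      ∀ i, C i ⟨j, hj⟩ = (Pi.single ⟨j, hj⟩ ‖dropResidual X M j‖ : M → ℝ) i := by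
  have hr : dropResidual X M j ≠ 0 := by
    intro h0
    rw [dropResidual, sub_eq_zero, eq_comm, Submodule.starProjection_eq_self_iff] at h0
    refine linearIndependent_iff_notMem_span.1 h ⟨j, hj⟩ (Submodule.span_mono ?_ h0)
    rintro _ ⟨k, rfl⟩
    refine ⟨⟨k, (Finset.mem_erase.1 k.2).2⟩, ⟨trivial, fun hk => ?_⟩, rfl⟩
    exact (Finset.mem_erase.1 k.2).1 (congrArg Subtype.val hk)
  let v : M → rowSpace X M := fun _ => ⟨dropDirection X M j, dropDirection_mem hj⟩
  have hv : Orthonormal ℝ (({⟨j, hj⟩} : Set M).domRestrict v) := by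
    rw [orthonormal_iff_ite]
    rintro ⟨i, hi⟩ ⟨k, hk⟩
    have : i = k := by rw [hi, hk]
    subst this
    simp [v, norm_dropDirection hr]
  obtain ⟨b, hb⟩ := Orthonormal.exists_orthonormalBasis_extension_of_card_eq
    (finrank_span_eq_card h) hv
  let x : M → rowSpace X M := fun i => ⟨rowVec X i, rowVec_mem_rowSpace i.2⟩
  refine ⟨Matrix.of fun i k => inner ℝ (x i) (b k), ?_, fun i => ?_⟩
  · ext i i'
    rw [Matrix.mul_apply, Matrix.mul_apply]
    have h1 := b.sum_inner_mul_inner (x i) (x i')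
    have h2 : ∀ k, inner ℝ (b k) (x i') = inner ℝ (x i') (b k) := fun k => real_inner_comm _ _
    simp only [h2] at h1
    refine h1.trans ?_
    simp [x, rowsOf, PiLp.inner_apply, mul_comm]
  · rw [← rowsOf_mulVec_dropDirection hj, Matrix.of_apply, hb _ rfl]
    simp [Matrix.mulVec, dotProduct, rowsOf, PiLp.inner_apply, x, v, mul_comm]

lemma invSqrt_posDef_facts {S : Matrix (Fin q) (Fin q) ℝ} (hS : S.PosDef) :
    invSqrt S * invSqrt S = S⁻¹ ∧ (invSqrt S).transpose = invSqrt S ∧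
      IsUnit (invSqrt S).det ∧ invSqrt S * S * invSqrt S = 1 := by
  obtain ⟨h1, h2, h3, -⟩ := sqrt_posDef_facts hS
  have h4 : IsUnit (CFC.sqrt S).det := h3.ne'.isUnit
  refine ⟨?_, ?_, ?_, ?_⟩
  · rw [invSqrt, ← Matrix.mul_inv_rev, h1]
  · rw [invSqrt, Matrix.transpose_nonsing_inv, h2]
  · rw [invSqrt, Matrix.isUnit_nonsing_inv_det_iff]; exact h4
  · rw [invSqrt]
    nth_rewrite 2 [← h1]
    rw [← Matrix.mul_assoc, Matrix.nonsing_inv_mul _ h4, Matrix.one_mul,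
      Matrix.mul_nonsing_inv _ h4]

/-! ### The fiducial expectation -/

/-- When `x_j` depends linearly on the other rows of `X_M`, a sparser approximation is exact. -/
lemma expectedH_eq_zero {ε : ℝ} (hε : 0 < ε) (hj : j ∈ M) (h : dropResidual X M j = 0) :
    expectedH X Y ε M = 0 := by
  have h1 : ∀ T : Fin q → M → ℝ, hFun X Y ε M (Matrix.of T) = 0 := by
    intro T
    rw [hFun, if_neg]
    intro hA
    have := hA.two_mul_le hj
    rw [h] at this
    simp at this
    linarith
  simp [expectedH, h1]

/-- If the data in the direction `u_j` are small, then `B_M` is admissible only if the standardized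
fiducial deviation in that direction is large. -/
lemma expectedH_le {ε δ : ℝ} (hε : 0 < ε) (hδ : 0 ≤ δ) (hj : j ∈ M)
    (hind : LinearIndependent ℝ fun i : M => rowVec X i) (hS : (sigmaHat X Y M).PosDef)
    (hY : ∑ a, ((invSqrt (sigmaHat X Y M)).mulVec (Y.mulVec (dropDirection X M j).ofLp) a) ^ 2 ≤
      (1.03 : ℝ) ^ 2 * ε)
    (htail : ∫⁻ t : EuclideanSpace ℝ (Fin q), Set.indicator {t | 9 / 64 * ε ≤ ‖t‖ ^ 2} 1 t *
          ENNReal.ofReal ((1 + ‖t‖ ^ 2) ^ (-((n : ℝ) - M.card + 1) / 2)) ≤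
        ENNReal.ofReal δ *
        ∫⁻ t : EuclideanSpace ℝ (Fin q),
          ENNReal.ofReal ((1 + ‖t‖ ^ 2) ^ (-((n : ℝ) - M.card + 1) / 2))) :
    expectedH X Y ε M ≤ δ := by
  obtain ⟨hRR, hRt, hR, -⟩ := invSqrt_posDef_facts hS
  set R := invSqrt (sigmaHat X Y M) with hRdef
  obtain ⟨C, hCC, hCj⟩ := exists_gram_factor hind hj
  have hG := posDef_rowsOf_mul_transpose hind
  have hGu : IsUnit (rowsOf X M * (rowsOf X M).transpose).det := hG.det_pos.ne'.isUnit
  have hC : IsUnit C.det := by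
    rw [← hCC, Matrix.det_mul] at hGu
    exact isUnit_of_mul_isUnit_left hGu
  have hCC' : C * C.transpose = ((rowsOf X M * (rowsOf X M).transpose)⁻¹)⁻¹ := by
    rw [Matrix.nonsing_inv_nonsing_inv _ hGu, hCC]
  have hν : (n : ℝ) - M.card - q + 1 + q = (n : ℝ) - M.card + 1 := by ring
  have htail' := matrixT_tail_le (ν := (n : ℝ) - M.card - q + 1) (μ := bHat X Y M) hRR hRt hR hCC'
    hC ⟨j, hj⟩ (9 / 64 * ε) δ (by rw [hν]; exact htail)
  set E : Set (Fin q → M → ℝ) :=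
    {T | 9 / 64 * ε ≤ ∑ a, (R * (Matrix.of T - bHat X Y M) * C) a ⟨j, hj⟩ ^ 2} with hE
  have hfin : IsFiniteMeasure (fiducial X Y M) :=
    ⟨(matrixT_univ_le _ _ _ _).trans_lt ENNReal.one_lt_top⟩
  have hEm : MeasurableSet E := by
    apply measurableSet_le measurable_const
    apply Continuous.measurable
    refine continuous_finsetSum _ fun a _ => Continuous.pow ?_ 2
    have : Continuous fun T : Fin q → M → ℝ => R * (Matrix.of T - bHat X Y M) * C := by
      apply Continuous.matrix_mul _ continuous_const
      apply Continuous.matrix_mul continuous_const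
      exact Continuous.sub continuous_id continuous_const
    exact this.matrix_elem a _
  have hsub : ∀ T : Fin q → M → ℝ, hFun X Y ε M (Matrix.of T) ≤ E.indicator 1 T := by
    intro T
    by_cases hA : Admissible X Y ε M (Matrix.of T)
    swap
    · rw [hFun, if_neg hA]
      exact Set.indicator_nonneg (fun _ _ => zero_le_one) _
    rw [hFun, if_pos hA, Set.indicator_of_mem]
    · rfl
    have h1 := hA.two_mul_le hj
    rw [← hRdef] at h1
    set d := ‖dropResidual X M j‖ with hd
    let x : EuclideanSpace ℝ (Fin q) := WithLp.toLp 2 (R.mulVec fun a => d * T a ⟨j, hj⟩)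
    let y : EuclideanSpace ℝ (Fin q) :=
      WithLp.toLp 2 (R.mulVec (Y.mulVec (dropDirection X M j).ofLp))
    have hx : 2 * ε ≤ ‖x‖ ^ 2 := by
      refine h1.trans_eq ?_
      have h2 : x = d • WithLp.toLp 2 (R.mulVec fun a => T a ⟨j, hj⟩) := by
        rw [← WithLp.toLp_smul, ← Matrix.mulVec_smul]
        rfl
      have h3 := EuclideanSpace.norm_sq_eq (𝕜 := ℝ)
        (WithLp.toLp 2 (R.mulVec fun a => T a ⟨j, hj⟩) : EuclideanSpace ℝ (Fin q))
      rw [h2, norm_smul, mul_pow, h3, Real.norm_eq_abs, sq_abs, mul_comm]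
      simp
    have hy : ‖y‖ ^ 2 ≤ (1.03 : ℝ) ^ 2 * ε := by
      rw [EuclideanSpace.norm_sq_eq]
      simpa [y] using hY
    have hxy : ∑ a, (R * (Matrix.of T - bHat X Y M) * C) a ⟨j, hj⟩ ^ 2 = ‖x - y‖ ^ 2 := by
      rw [EuclideanSpace.norm_sq_eq]
      refine Finset.sum_congr rfl fun a _ => ?_
      rw [Real.norm_eq_abs, sq_abs]
      congr 1
      have h2 : (R * (Matrix.of T - bHat X Y M) * C) a ⟨j, hj⟩ =
          (R * (Matrix.of T - bHat X Y M)) a ⟨j, hj⟩ * d := by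
        rw [Matrix.mul_apply]
        simp only [hCj]
        rw [Finset.sum_eq_single ⟨j, hj⟩]
        · rw [Pi.single_eq_same]
        · intro i _ hi
          rw [Pi.single_eq_of_ne hi, mul_zero]
        · simp
      rw [h2, Matrix.mul_apply, Finset.sum_mul]
      simp only [PiLp.sub_apply, x, y, Matrix.mulVec, dotProduct]
      rw [← Finset.sum_sub_distrib]
      refine Finset.sum_congr rfl fun b _ => ?_
      have h3 := norm_mul_bHat (Y := Y) hind hj b
      simp only [Matrix.mulVec, dotProduct] at h3
      rw [← h3]
      simp only [Matrix.sub_apply, Matrix.of_apply]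
      ring
    show 9 / 64 * ε ≤ ∑ a, (R * (Matrix.of T - bHat X Y M) * C) a ⟨j, hj⟩ ^ 2
    rw [hxy]
    -- the reverse triangle inequality, with `√2 ≥ 1.41 ≥ 3/8 + 1.03`
    obtain ⟨s, hs0, hs⟩ : ∃ s : ℝ, 0 < s ∧ s ^ 2 = ε :=
      ⟨Real.sqrt ε, Real.sqrt_pos.2 hε, Real.sq_sqrt hε.le⟩
    have h4 : 1.41 * s ≤ ‖x‖ := by
      apply le_of_sq_le_sq _ (norm_nonneg _)
      nlinarith
    have h5 : ‖y‖ ≤ 1.03 * s := by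
      apply le_of_sq_le_sq _ (by positivity)
      rw [mul_pow, hs]; exact hy
    have h6 : 3 / 8 * s ≤ ‖x - y‖ := by
      have := norm_sub_norm_le x y
      linarith
    calc 9 / 64 * ε = (3 / 8 * s) ^ 2 := by rw [mul_pow, hs]; norm_num
      _ ≤ _ := by gcongr
  have h1 : expectedH X Y ε M ≤ ∫ T, E.indicator 1 T ∂(fiducial X Y M) := by
    refine integral_mono_of_nonneg (ae_of_all _ fun T => ?_)
      ((integrable_const (1 : ℝ)).indicator hEm) (ae_of_all _ hsub)
    simp only [hFun, Pi.zero_apply]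
    split_ifs <;> norm_num
  refine h1.trans ?_
  rw [integral_indicator_one hEm]
  exact ENNReal.toReal_le_of_le_ofReal hδ htail'

end

section

variable {p q n : ℕ} {X : Matrix (Fin p) (Fin n) ℝ} {Y : Matrix (Fin q) (Fin n) ℝ}
  {M : Finset (Fin p)} {j : Fin p}

/-! ### Extreme eigenvalues and quadratic forms -/

lemma eigMin_facts (hq : 0 < q) {V : Matrix (Fin q) (Fin q) ℝ} (hV : V.PosDef) :
    0 < eigMin V ∧ eigMin V ≤ eigMax V ∧
      ∀ v : Fin q → ℝ, eigMin V * (v ⬝ᵥ v) ≤ v ⬝ᵥ V.mulVec v := by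
  have hspec := hV.1.spectrum_real_eq_range_eigenvalues
  have hfin : (spectrum ℝ V).Finite := by rw [hspec]; exact Set.finite_range _
  have hne : (spectrum ℝ V).Nonempty := by
    rw [hspec]
    have : Nonempty (Fin q) := ⟨⟨0, hq⟩⟩
    exact Set.range_nonempty _
  refine ⟨?_, (csInf_le hfin.bddBelow hne.some_mem).trans (le_csSup hfin.bddAbove hne.some_mem),
    fun v => ?_⟩
  · have h1 : sInf (spectrum ℝ V) ∈ spectrum ℝ V := hne.csInf_mem hfin
    rw [hspec] at h1
    obtain ⟨i, hi⟩ := h1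
    rw [eigMin, hspec, ← hi]
    exact hV.eigenvalues_pos i
  · have hsa : IsSelfAdjoint V := hV.1
    have h1 : algebraMap ℝ (Matrix (Fin q) (Fin q) ℝ) (eigMin V) ≤ V :=
      algebraMap_le_of_le_spectrum fun x hx => csInf_le hfin.bddBelow hx
    rw [Matrix.le_iff] at h1
    have h2 := h1.dotProduct_mulVec_nonneg v
    rw [Algebra.algebraMap_eq_smul_one, Matrix.sub_mulVec, Matrix.smul_mulVec, Matrix.one_mulVec,
      dotProduct_sub, dotProduct_smul, star_trivial, smul_eq_mul] at h2
    linarith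

/-- If `S ≥ c L²` then `‖S ^ (-1/2) L‖² ≤ 1 / c`, because this bound holds for the transpose
`L S ^ (-1/2)`. -/
lemma mul_dotProduct_mulVec_le {S R L : Matrix (Fin q) (Fin q) ℝ} {c : ℝ} (hc : 0 ≤ c)
    (hRt : R.transpose = R) (hLt : L.transpose = L) (hRSR : R * S * R = 1)
    (h : ∀ v, c * (L.mulVec v ⬝ᵥ L.mulVec v) ≤ v ⬝ᵥ S.mulVec v) (ζ : Fin q → ℝ) :
    c * (R.mulVec (L.mulVec ζ) ⬝ᵥ R.mulVec (L.mulVec ζ)) ≤ ζ ⬝ᵥ ζ := by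
  have hsymm : ∀ (A : Matrix (Fin q) (Fin q) ℝ), A.transpose = A → ∀ x y : Fin q → ℝ,
      x ⬝ᵥ A.mulVec y = A.mulVec x ⬝ᵥ y := by
    intro A hA x y
    rw [Matrix.dotProduct_mulVec, ← Matrix.mulVec_transpose, hA]
  set x := R.mulVec (L.mulVec ζ) with hx
  set y := L.mulVec (R.mulVec x) with hy
  have h1 : x ⬝ᵥ x = y ⬝ᵥ ζ := by
    conv_lhs => rw [hx]
    rw [← hx, hsymm R hRt, hsymm L hLt]
  have h2 : c * (y ⬝ᵥ y) ≤ x ⬝ᵥ x := by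
    refine (h (R.mulVec x)).trans_eq ?_
    rw [← hsymm R hRt, Matrix.mulVec_mulVec, Matrix.mulVec_mulVec, hRSR, Matrix.one_mulVec]
  have h3 : (y ⬝ᵥ ζ) ^ 2 ≤ (y ⬝ᵥ y) * (ζ ⬝ᵥ ζ) := by
    have := Finset.sum_mul_sq_le_sq_mul_sq Finset.univ y ζ
    simpa [dotProduct, sq] using this
  have hx0 : 0 ≤ x ⬝ᵥ x := Finset.sum_nonneg fun i _ => mul_self_nonneg _
  have hζ0 : 0 ≤ ζ ⬝ᵥ ζ := Finset.sum_nonneg fun i _ => mul_self_nonneg _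
  rw [← h1] at h3
  rcases hx0.eq_or_lt with h0 | h0
  · rw [← h0, mul_zero]; exact hζ0
  · have h4 : (x ⬝ᵥ x) * (c * (x ⬝ᵥ x)) ≤ (x ⬝ᵥ x) * (ζ ⬝ᵥ ζ) := by
      calc (x ⬝ᵥ x) * (c * (x ⬝ᵥ x)) = c * (x ⬝ᵥ x) ^ 2 := by ring
        _ ≤ c * ((y ⬝ᵥ y) * (ζ ⬝ᵥ ζ)) := by gcongr
        _ = (c * (y ⬝ᵥ y)) * (ζ ⬝ᵥ ζ) := by ring
        _ ≤ (x ⬝ᵥ x) * (ζ ⬝ᵥ ζ) := by gcongr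
    exact le_of_mul_le_mul_left h4 h0

/-! ### The residual matrix -/

lemma transpose_hatMatrix : (hatMatrix X M).transpose = hatMatrix X M := by
  have h : star (hatMatrix X M) = hatMatrix X M := by
    have h1 : star (rowSpace X M).starProjection = (rowSpace X M).starProjection :=
      isSelfAdjoint_starProjection _
    have h2 := (Matrix.toEuclideanCLM (n := Fin n) (𝕜 := ℝ)).symm.map_star'
      (rowSpace X M).starProjection
    rw [h1] at h2
    exact h2.symm
  rwa [Matrix.star_eq_conjTranspose, Matrix.conjTranspose_eq_transpose_of_trivial] at h

lemma isHermitian_sigmaHat : (sigmaHat X Y M).IsHermitian := by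
  rw [Matrix.IsHermitian, Matrix.conjTranspose_eq_transpose_of_trivial, sigmaHat,
    Matrix.transpose_mul, Matrix.transpose_mul, Matrix.transpose_sub, transpose_hatMatrix,
    Matrix.transpose_one, Matrix.transpose_transpose, Matrix.mul_assoc]

/-- Bessel's inequality for the quadratic form of the residual matrix. -/
lemma sum_inner_sq_le_sigmaHat {κ : Type*} [Fintype κ] {w : κ → EuclideanSpace ℝ (Fin n)}
    (hw : Orthonormal ℝ w) (hwX : ∀ i, ∀ x ∈ rowSpace X M, inner ℝ (w i) x = 0)
    (v : Fin q → ℝ) :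
    ∑ i, (v ⬝ᵥ Y.mulVec (w i).ofLp) ^ 2 ≤ v ⬝ᵥ (sigmaHat X Y M).mulVec v := by
  let y : EuclideanSpace ℝ (Fin n) := WithLp.toLp 2 (Y.transpose.mulVec v)
  have h1 : v ⬝ᵥ (sigmaHat X Y M).mulVec v = ‖y - (rowSpace X M).starProjection y‖ ^ 2 := by
    have h2 : v ⬝ᵥ (sigmaHat X Y M).mulVec v =
        inner ℝ y (y - (rowSpace X M).starProjection y) := by
      rw [sigmaHat, ← Matrix.mulVec_mulVec, ← Matrix.mulVec_mulVec, Matrix.dotProduct_mulVec,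
        ← Matrix.mulVec_transpose, Matrix.sub_mulVec, Matrix.one_mulVec,
        show Y.transpose.mulVec v = y.ofLp from rfl, hatMatrix_mulVec, ← WithLp.ofLp_sub]
      rw [EuclideanSpace.inner_eq_star_dotProduct, star_trivial, dotProduct_comm]
    rw [h2, ← real_inner_self_eq_norm_sq, inner_sub_left y,
      real_inner_comm _ ((rowSpace X M).starProjection y),
      Submodule.starProjection_inner_eq_zero _ _ (Submodule.starProjection_apply_mem _ _), sub_zero]
  rw [h1]
  refine le_trans (le_of_eq (Finset.sum_congr rfl fun i _ => ?_))
    (hw.sum_inner_products_le (s := Finset.univ) (y - (rowSpace X M).starProjection y))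
  rw [inner_sub_right, hwX i _ (Submodule.starProjection_apply_mem _ _), sub_zero,
    Real.norm_eq_abs, sq_abs, EuclideanSpace.inner_eq_star_dotProduct, star_trivial,
    Matrix.dotProduct_mulVec, ← Matrix.mulVec_transpose]

lemma dotProduct_dataMatrix_sample {V : Matrix (Fin q) (Fin q) ℝ}
    {μ : Matrix (Fin q) (Fin n) ℝ} (hLt : (CFC.sqrt V).transpose = CFC.sqrt V) (z : Noise q n)
    (w : EuclideanSpace ℝ (Fin n)) (v : Fin q → ℝ) :
    v ⬝ᵥ (dataMatrix (sample μ V z)).mulVec w.ofLp = v ⬝ᵥ μ.mulVec w.ofLp +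
      inner ℝ (tensor w (WithLp.toLp 2 ((CFC.sqrt V).mulVec v))) z := by
  have h1 : (dataMatrix (sample μ V z)).mulVec w.ofLp = μ.mulVec w.ofLp +
      (CFC.sqrt V).mulVec (fun b => ∑ l, w l * z l b) := by
    ext a
    simp only [Matrix.mulVec, dotProduct, dataMatrix, sample, Matrix.of_apply, PiLp.add_apply,
      Matrix.ofLp_toEuclideanCLM, Pi.add_apply, add_mul, Finset.sum_add_distrib, Finset.sum_mul,
      Finset.mul_sum]
    congr 1
    rw [Finset.sum_comm]
    refine Finset.sum_congr rfl fun b _ => Finset.sum_congr rfl fun l _ => by ring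
  rw [h1, dotProduct_add, Matrix.dotProduct_mulVec v (CFC.sqrt V),
    ← Matrix.mulVec_transpose, hLt]
  congr 1
  rw [PiLp.inner_apply]
  simp only [tensor, dotProduct, Finset.mul_sum, PiLp.inner_apply]
  rw [Finset.sum_comm]
  refine Finset.sum_congr rfl fun b _ => Finset.sum_congr rfl fun l _ => ?_
  simp
  ring

/-- A lower bound for `‖(⟨w_i, Zᵀ v⟩)_i‖` on a net of the unit sphere, with a bound for `‖Z‖_F`,
gives one for all `v`. -/
lemma mul_norm_sq_le_sum_inner_tensor (hq : 0 < q) {κ : Type*} [Fintype κ]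
    {w : κ → EuclideanSpace ℝ (Fin n)} (hw : Orthonormal ℝ w) {k : ℝ} (hk : 0 < k)
    {N : Set (EuclideanSpace ℝ (Fin q))}
    (hN : ∀ v : EuclideanSpace ℝ (Fin q), ‖v‖ = 1 → ∃ v' ∈ N, ‖v - v'‖ ≤ 1 / (40 * Real.sqrt q))
    {z : Noise q n} (hz : ‖z‖ ^ 2 ≤ 4 * q * k)
    (hzN : ∀ v ∈ N, k / 2 ≤ ∑ i, inner ℝ (tensor (w i) v) z ^ 2)
    (v : EuclideanSpace ℝ (Fin q)) :
    0.4225 * k * ‖v‖ ^ 2 ≤ ∑ i, inner ℝ (tensor (w i) v) z ^ 2 := by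
  let A : EuclideanSpace ℝ (Fin q) → EuclideanSpace ℝ κ := fun v =>
    WithLp.toLp 2 fun i => inner ℝ (tensor (w i) v) z
  have hA : ∀ v, ∑ i, inner ℝ (tensor (w i) v) z ^ 2 = ‖A v‖ ^ 2 := by
    intro v
    rw [EuclideanSpace.norm_sq_eq]
    simp [A]
  have hts : ∀ (c : ℝ) (i : κ) (v : EuclideanSpace ℝ (Fin q)),
      tensor (w i) (c • v) = c • tensor (w i) v := by
    intro c i v
    ext l a
    simp [tensor]
    ring
  have htd : ∀ (i : κ) (v v' : EuclideanSpace ℝ (Fin q)),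
      tensor (w i) (v - v') = tensor (w i) v - tensor (w i) v' := by
    intro i v v'
    ext l a
    simp [tensor]
    ring
  have hAs : ∀ (c : ℝ) v, A (c • v) = c • A v := by
    intro c v
    ext i
    simp [A, hts, real_inner_smul_left]
  have hAd : ∀ v v', A (v - v') = A v - A v' := by
    intro v v'
    ext i
    simp [A, htd, inner_sub_left]
  have hunit : ∀ v : EuclideanSpace ℝ (Fin q), v ≠ 0 →
      ∃ e : EuclideanSpace ℝ (Fin q), ‖e‖ = 1 ∧ v = ‖v‖ • e := by
    intro v hv
    have h0 : ‖v‖ ≠ 0 := norm_ne_zero_iff.2 hv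
    refine ⟨‖v‖⁻¹ • v, ?_, ?_⟩
    · rw [norm_smul, norm_inv, norm_norm, inv_mul_cancel₀ h0]
    · rw [smul_smul, mul_inv_cancel₀ h0, one_smul]
  have hup : ∀ v, ‖A v‖ ≤ ‖z‖ * ‖v‖ := by
    intro v
    rcases eq_or_ne v 0 with rfl | hv
    · have : A 0 = 0 := by
        have := hAs 0 0
        simpa using this
      simp [this]
    · obtain ⟨e, he, hve⟩ := hunit v hv
      have h1 : ‖A e‖ ^ 2 ≤ ‖z‖ ^ 2 := by
        rw [← hA]
        refine le_trans (le_of_eq (Finset.sum_congr rfl fun i _ => ?_))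
          ((orthonormal_tensor_left hw he).sum_inner_products_le (s := Finset.univ) z)
        rw [Real.norm_eq_abs, sq_abs]
      have h2 : ‖A e‖ ≤ ‖z‖ := le_of_sq_le_sq h1 (norm_nonneg _)
      rw [hve, hAs, norm_smul, norm_norm, ← hve, mul_comm]
      gcongr
  have hqs : 0 < Real.sqrt q := Real.sqrt_pos.2 (by exact_mod_cast hq)
  obtain ⟨s, hs0, hs⟩ : ∃ s : ℝ, 0 < s ∧ s ^ 2 = k :=
    ⟨Real.sqrt k, Real.sqrt_pos.2 hk, Real.sq_sqrt hk.le⟩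
  have hz' : ‖z‖ ≤ 2 * Real.sqrt q * s := by
    apply le_of_sq_le_sq _ (by positivity)
    rw [mul_pow, mul_pow, Real.sq_sqrt (by positivity), hs]
    linarith
  -- on the net the norm is at least `√(k/2) ≥ 0.7 √k`, and passing to `e` loses at most `0.05 √k`
  have hlow : ∀ e : EuclideanSpace ℝ (Fin q), ‖e‖ = 1 → 0.65 * s ≤ ‖A e‖ := by
    intro e he
    obtain ⟨v', hv', hd⟩ := hN e he
    have h1 : 0.7 * s ≤ ‖A v'‖ := by
      apply le_of_sq_le_sq _ (norm_nonneg _)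
      rw [← hA]
      refine le_trans ?_ (hzN v' hv')
      rw [mul_pow, hs]
      linarith
    have h2 : ‖A (e - v')‖ ≤ 0.05 * s := by
      refine (hup _).trans ?_
      calc ‖z‖ * ‖e - v'‖ ≤ 2 * Real.sqrt q * s * (1 / (40 * Real.sqrt q)) := by gcongr
        _ = 0.05 * s := by field_simp; norm_num
    rw [hAd] at h2
    have h3 := norm_sub_norm_le (A v') (A e)
    rw [norm_sub_rev] at h3
    linarith
  rw [hA]
  rcases eq_or_ne v 0 with rfl | hv
  · simp
  · obtain ⟨e, he, hve⟩ := hunit v hv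
    have h1 := hlow e he
    rw [hve, hAs, norm_smul (‖v‖) (A e), norm_norm, ← hve, mul_pow, ← hs]
    have h2 : (0.65 * s) ^ 2 ≤ ‖A e‖ ^ 2 := by gcongr
    have h3 : 0 ≤ ‖v‖ ^ 2 := by positivity
    nlinarith

/-! ### Samples with a well-behaved noise matrix -/

/-- On the event that the noise is well behaved, the residual matrix is positive definite and the
data in a direction with small signal are small after standardization. -/
lemma standardized_data_le (hq : 0 < q) {V : Matrix (Fin q) (Fin q) ℝ} (hV : V.PosDef)
    {μ : Matrix (Fin q) (Fin n) ℝ} {κ : Type*} [Fintype κ]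
    {w : κ → EuclideanSpace ℝ (Fin n)} (hw : Orthonormal ℝ w)
    (hwX : ∀ i, ∀ x ∈ rowSpace X M, inner ℝ (w i) x = 0)
    (hwμ : ∀ i, μ.mulVec (w i).ofLp = 0) {k ε : ℝ} (hk : 0 < k)
    {N : Set (EuclideanSpace ℝ (Fin q))}
    (hN : ∀ v : EuclideanSpace ℝ (Fin q), ‖v‖ = 1 → ∃ v' ∈ N, ‖v - v'‖ ≤ 1 / (40 * Real.sqrt q))
    {z : Noise q n} (hz : ‖z‖ ^ 2 ≤ 4 * q * k)
    (hzN : ∀ v ∈ N, k / 2 ≤ ∑ i, inner ℝ (tensor (w i) v) z ^ 2)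
    {u : EuclideanSpace ℝ (Fin n)}
    (hzu : ∑ a, inner ℝ (tensor u (EuclideanSpace.basisFun (Fin q) ℝ a)) z ^ 2 ≤ ε * k / 9)
    (hμu : 9 / (eigMin V * k) * ∑ a, μ.mulVec u.ofLp a ^ 2 ≤ ε) :
    (sigmaHat X (dataMatrix (sample μ V z)) M).PosDef ∧
      ∑ a, ((invSqrt (sigmaHat X (dataMatrix (sample μ V z)) M)).mulVec
        ((dataMatrix (sample μ V z)).mulVec u.ofLp) a) ^ 2 ≤ (1.03 : ℝ) ^ 2 * ε := by
  obtain ⟨hLL, hLt, -, -⟩ := sqrt_posDef_facts hV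
  obtain ⟨hlam, -, hlamV⟩ := eigMin_facts hq hV
  set L := CFC.sqrt V
  set Y := dataMatrix (sample μ V z) with hY
  set S := sigmaHat X Y M with hSdef
  have hLv : ∀ v : Fin q → ℝ, L.mulVec v ⬝ᵥ L.mulVec v = v ⬝ᵥ V.mulVec v := by
    intro v
    rw [← hLL, ← Matrix.mulVec_mulVec, Matrix.dotProduct_mulVec v, ← Matrix.mulVec_transpose, hLt]
  have hSL : ∀ v : Fin q → ℝ, 0.4225 * k * (L.mulVec v ⬝ᵥ L.mulVec v) ≤ v ⬝ᵥ S.mulVec v := by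
    intro v
    refine le_trans ?_ (sum_inner_sq_le_sigmaHat hw hwX v)
    have h1 := mul_norm_sq_le_sum_inner_tensor hq hw hk hN hz hzN (WithLp.toLp 2 (L.mulVec v))
    rw [EuclideanSpace.norm_sq_eq] at h1
    have h2 : ∀ i, v ⬝ᵥ Y.mulVec (w i).ofLp =
        inner ℝ (tensor (w i) (WithLp.toLp 2 (L.mulVec v))) z := by
      intro i
      rw [hY, dotProduct_dataMatrix_sample hLt, hwμ, dotProduct_zero, zero_add]
    simp only [h2]
    refine le_trans (le_of_eq ?_) h1
    simp [dotProduct, sq]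
  have hSlam : ∀ v : Fin q → ℝ, 0.4225 * k * eigMin V *
      ((1 : Matrix (Fin q) (Fin q) ℝ).mulVec v ⬝ᵥ (1 : Matrix (Fin q) (Fin q) ℝ).mulVec v) ≤
      v ⬝ᵥ S.mulVec v := by
    intro v
    refine le_trans ?_ (hSL v)
    rw [hLv, Matrix.one_mulVec, mul_assoc]
    have := hlamV v
    gcongr
  have hS : S.PosDef := by
    refine Matrix.PosDef.of_dotProduct_mulVec_pos isHermitian_sigmaHat fun v hv => ?_
    rw [star_trivial]
    refine lt_of_lt_of_le ?_ (hSL v)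
    rw [hLv]
    have := hV.dotProduct_mulVec_pos hv
    rw [star_trivial] at this
    positivity
  refine ⟨hS, ?_⟩
  obtain ⟨-, hRt, -, hRSR⟩ := invSqrt_posDef_facts hS
  set R := invSqrt S
  let ζ : Fin q → ℝ := fun a => inner ℝ (tensor u (EuclideanSpace.basisFun (Fin q) ℝ a)) z
  have hYu : Y.mulVec u.ofLp = μ.mulVec u.ofLp + L.mulVec ζ := by
    have htl : ∀ v : Fin q → ℝ, v ⬝ᵥ ζ = inner ℝ (tensor u (WithLp.toLp 2 v)) z := by
      intro v
      have h1 : tensor u (WithLp.toLp 2 v) =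
          ∑ a, v a • (tensor u (EuclideanSpace.basisFun (Fin q) ℝ a) : Noise q n) := by
        ext l b
        simp [tensor, mul_comm, Pi.single_apply]
      rw [h1, sum_inner]
      simp [real_inner_smul_left, dotProduct, ζ]
    apply dotProduct_eq
    intro v
    rw [dotProduct_comm, hY, dotProduct_dataMatrix_sample hLt, dotProduct_comm (_ + _) v,
      dotProduct_add, Matrix.dotProduct_mulVec v L, ← Matrix.mulVec_transpose, hLt, htl]
  have h1 := mul_dotProduct_mulVec_le (by positivity) hRt hLt hRSR hSL ζ
  have h2 := mul_dotProduct_mulVec_le (by positivity) hRt Matrix.transpose_one hRSR hSlam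
    (μ.mulVec u.ofLp)
  rw [Matrix.one_mulVec] at h2
  have h3 : ζ ⬝ᵥ ζ ≤ ε * k / 9 := by
    refine le_trans (le_of_eq ?_) hzu
    simp [dotProduct, sq, ζ]
  have h4 : μ.mulVec u.ofLp ⬝ᵥ μ.mulVec u.ofLp ≤ ε * k * eigMin V / 9 := by
    have : μ.mulVec u.ofLp ⬝ᵥ μ.mulVec u.ofLp = ∑ a, μ.mulVec u.ofLp a ^ 2 := by
      simp [dotProduct, sq]
    rw [this]
    rw [div_mul_eq_mul_div, div_le_iff₀ (by positivity)] at hμu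
    linarith
  set x := R.mulVec (L.mulVec ζ)
  set y := R.mulVec (μ.mulVec u.ofLp)
  -- `1 / (9 * 0.4225) ≤ 0.263`, and `4 * 0.263 ≤ 1.03 ^ 2`
  have hx : x ⬝ᵥ x ≤ 0.263 * ε := by
    have h5 := h1.trans h3
    have h6 : k * (0.4225 * (x ⬝ᵥ x)) ≤ k * (ε / 9) := by linarith
    have h7 := le_of_mul_le_mul_left h6 hk
    have h8 : 0 ≤ x ⬝ᵥ x := Finset.sum_nonneg fun i _ => mul_self_nonneg _
    linarith
  have hy : y ⬝ᵥ y ≤ 0.263 * ε := by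
    have h5 := h2.trans h4
    have h6 : (k * eigMin V) * (0.4225 * (y ⬝ᵥ y)) ≤ (k * eigMin V) * (ε / 9) := by linarith
    have h7 := le_of_mul_le_mul_left h6 (by positivity)
    have h8 : 0 ≤ y ⬝ᵥ y := Finset.sum_nonneg fun i _ => mul_self_nonneg _
    linarith
  have h9 : ∑ a, (R.mulVec (Y.mulVec u.ofLp) a) ^ 2 ≤ 2 * (y ⬝ᵥ y) + 2 * (x ⬝ᵥ x) := by
    rw [hYu, Matrix.mulVec_add]
    simp only [dotProduct, Finset.mul_sum, ← Finset.sum_add_distrib]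
    refine Finset.sum_le_sum fun a _ => ?_
    simp only [Pi.add_apply]
    nlinarith [sq_nonneg (y a - x a)]
  have h10 : 0 ≤ x ⬝ᵥ x := Finset.sum_nonneg fun i _ => mul_self_nonneg _
  nlinarith

lemma sum_sq_mulVec_le_dropChange {Mo : Finset (Fin p)} {B0 : Matrix (Fin q) Mo ℝ} (hj : j ∈ M)
    (hr : dropResidual X M j ≠ 0) :
    ∑ a, (B0 * rowsOf X Mo).mulVec (dropDirection X M j).ofLp a ^ 2 ≤
      dropChange X Mo B0 M j := by
  set u := dropDirection X M j with hu
  have h1 : (hatMatrix X M - hatMatrix X (M.erase j)).mulVec u.ofLp = u.ofLp := by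
    rw [Matrix.sub_mulVec, hatMatrix_mulVec, hatMatrix_mulVec,
      Submodule.starProjection_eq_self_iff.2 (dropDirection_mem hj)]
    have h2 : (rowSpace X (M.erase j)).starProjection u = 0 := by
      rw [Submodule.starProjection_apply_eq_zero_iff, Submodule.mem_orthogonal']
      exact fun x hx => inner_dropDirection_of_mem hx
    rw [h2]
    simp [hu]
  have h3 : ∑ l, u l ^ 2 = 1 := by
    have := norm_dropDirection hr
    rw [← hu] at this
    have h4 := EuclideanSpace.norm_sq_eq u
    rw [this] at h4
    simpa using h4.symm
  rw [dropChange, frobSq]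
  refine Finset.sum_le_sum fun a _ => ?_
  set D := B0 * rowsOf X Mo * (hatMatrix X M - hatMatrix X (M.erase j)) with hD
  have h5 : (B0 * rowsOf X Mo).mulVec u.ofLp = D.mulVec u.ofLp := by
    rw [hD, ← Matrix.mulVec_mulVec u.ofLp (B0 * rowsOf X Mo) (hatMatrix X M - _), h1]
  rw [h5]
  have h6 := Finset.sum_mul_sq_le_sq_mul_sq Finset.univ (fun l => D a l) (fun l => u l)
  rw [h3, mul_one] at h6
  exact h6

/-- There are at least `n - |M| - q` orthonormal directions orthogonal to the rows of `X_M` and of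
the mean. -/
lemma exists_orthonormal_residual (X : Matrix (Fin p) (Fin n) ℝ) (M : Finset (Fin p))
    (μ : Matrix (Fin q) (Fin n) ℝ) :
    ∃ (d : ℕ) (w : Fin d → EuclideanSpace ℝ (Fin n)), n ≤ d + M.card + q ∧ Orthonormal ℝ w ∧
      (∀ i, ∀ x ∈ rowSpace X M, inner ℝ (w i) x = 0) ∧ ∀ i, μ.mulVec (w i).ofLp = 0 := by
  let Kμ : Submodule ℝ (EuclideanSpace ℝ (Fin n)) :=
    Submodule.span ℝ (Set.range fun a : Fin q => (WithLp.toLp 2 (μ a) : EuclideanSpace ℝ (Fin n)))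
  let K := rowSpace X M ⊔ Kμ
  let b := stdOrthonormalBasis ℝ Kᗮ
  refine ⟨Module.finrank ℝ Kᗮ, fun i => (b i : EuclideanSpace ℝ (Fin n)), ?_, ?_, ?_, ?_⟩
  · have h1 := Submodule.finrank_add_finrank_orthogonal K
    rw [finrank_euclideanSpace_fin] at h1
    have h2 : Module.finrank ℝ K ≤ Module.finrank ℝ (rowSpace X M) + Module.finrank ℝ Kμ :=
      Submodule.finrank_add_le_finrank_add_finrank _ _
    have h3 : Module.finrank ℝ (rowSpace X M) ≤ M.card := by
      have := finrank_range_le_card (R := ℝ) (fun j : M => rowVec X j)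
      simpa [Set.finrank] using this
    have h4 : Module.finrank ℝ Kμ ≤ q := by
      have := finrank_range_le_card (R := ℝ)
        (fun a : Fin q => (WithLp.toLp 2 (μ a) : EuclideanSpace ℝ (Fin n)))
      simpa [Set.finrank] using this
    omega
  · exact b.orthonormal.comp_linearIsometry Kᗮ.subtypeₗᵢ
  · intro i x hx
    have h1 := (Submodule.mem_orthogonal' K _).1 (b i).2
    exact h1 x (Submodule.mem_sup_left hx)
  · intro i
    ext a
    have h1 := (Submodule.mem_orthogonal' K _).1 (b i).2
      (WithLp.toLp 2 (μ a)) (Submodule.mem_sup_right (Submodule.subset_span ⟨a, rfl⟩))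
    rw [EuclideanSpace.inner_eq_star_dotProduct] at h1
    simpa [Matrix.mulVec] using h1

end

/-! ### The exceptional event of one model -/

lemma exists_finset_net (q : ℕ) {δ : ℝ} (hδ : 0 < δ) :
    ∃ N : Finset (EuclideanSpace ℝ (Fin q)), (∀ v ∈ N, ‖v‖ = 1) ∧
      ∀ v : EuclideanSpace ℝ (Fin q), ‖v‖ = 1 → ∃ v' ∈ N, ‖v - v'‖ ≤ δ := by
  obtain ⟨t, ht, hfin, hcov⟩ := finite_cover_balls_of_compact
    (isCompact_sphere (0 : EuclideanSpace ℝ (Fin q)) 1) hδ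
  refine ⟨hfin.toFinset, fun v hv => ?_, fun v hv => ?_⟩
  · simpa using ht (hfin.mem_toFinset.1 hv)
  · have h := hcov (show v ∈ Metric.sphere 0 1 by simpa using hv)
    simp only [Set.mem_iUnion] at h
    obtain ⟨v', hv', hb⟩ := h
    refine ⟨v', hfin.mem_toFinset.2 hv', ?_⟩
    rw [← dist_eq_norm]
    exact (Metric.mem_ball.1 hb).le

/-- Both chi-squared bounds for the noise decay faster than `exp (-0.04 k)`: the exponents are
`1/4 - log 2 / 2 < -0.09` and `-q (1 - log 2)`. -/
lemma exists_forall_chiSq_bounds_le {q : ℕ} (hq : 0 < q) (c : ℕ) :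
    ∃ K : ℝ, ∀ (k : ℝ) (n d : ℕ), K ≤ k → 0 < k → (n : ℝ) ≤ 2 * k → k ≤ d + q →
      c * (Real.exp (k / 4) * (2 : ℝ) ^ (-((d : ℝ) / 2))) ≤ Real.exp (-0.04 * k) ∧
      Real.exp (-(q * k)) * (1 / 2 : ℝ) ^ (-((n * q : ℕ) / 2 : ℝ)) ≤ Real.exp (-0.04 * k) := by
  have h1 : Tendsto (fun k : ℝ => Real.exp (0.05 * k)) atTop atTop :=
    Real.tendsto_exp_atTop.comp (tendsto_id.const_mul_atTop (by norm_num))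
  obtain ⟨K, hK⟩ := Filter.eventually_atTop.1
    (h1.eventually_ge_atTop (c * (2 : ℝ) ^ ((q : ℝ) / 2)))
  refine ⟨K, fun k n d hk hk0 hn hd => ⟨?_, ?_⟩⟩
  · have hl := Real.log_two_gt_d9
    have h2 : (2 : ℝ) ^ (-((d : ℝ) / 2)) ≤
        (2 : ℝ) ^ ((q : ℝ) / 2) * Real.exp (-(0.34 * k)) := by
      calc (2 : ℝ) ^ (-((d : ℝ) / 2)) ≤ (2 : ℝ) ^ ((q : ℝ) / 2 + -(k / 2)) :=
            Real.rpow_le_rpow_of_exponent_le (by norm_num) (by linarith)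
        _ = (2 : ℝ) ^ ((q : ℝ) / 2) * (2 : ℝ) ^ (-(k / 2)) := Real.rpow_add (by norm_num) _ _
        _ ≤ _ := by
          gcongr
          rw [Real.rpow_def_of_pos (by norm_num)]
          apply Real.exp_le_exp.2
          nlinarith
    calc c * (Real.exp (k / 4) * (2 : ℝ) ^ (-((d : ℝ) / 2)))
        ≤ c * (Real.exp (k / 4) * ((2 : ℝ) ^ ((q : ℝ) / 2) * Real.exp (-(0.34 * k)))) := by gcongr
      _ = (c * (2 : ℝ) ^ ((q : ℝ) / 2)) * Real.exp (-0.09 * k) := by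
        rw [show Real.exp (-0.09 * k) = Real.exp (k / 4) * Real.exp (-(0.34 * k)) by
          rw [← Real.exp_add]; ring_nf]
        ring
      _ ≤ Real.exp (0.05 * k) * Real.exp (-0.09 * k) := by
        gcongr
        exact hK k hk
      _ = Real.exp (-0.04 * k) := by rw [← Real.exp_add]; ring_nf
  · rw [Real.rpow_def_of_pos (by norm_num), ← Real.exp_add]
    apply Real.exp_le_exp.2
    have hl := Real.log_two_lt_d9
    have hl0 : 0 < Real.log 2 := Real.log_pos (by norm_num)
    rw [one_div, Real.log_inv]
    push_cast
    have hq1 : (1 : ℝ) ≤ q := by exact_mod_cast hq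
    have h3 : (n : ℝ) * q * Real.log 2 ≤ 2 * k * q * 0.7 := by
      gcongr
      linarith
    nlinarith

/-- The probability that the noise is badly behaved for a given model: too small in one of the
directions of a net, too large altogether, or too large in the direction `u`. -/
lemma stdGaussian_real_bad_le {q n d : ℕ} (N : Finset (EuclideanSpace ℝ (Fin q)))
    (hN : ∀ v ∈ N, ‖v‖ = 1) {w : Fin d → EuclideanSpace ℝ (Fin n)} (hw : Orthonormal ℝ w)
    {u : EuclideanSpace ℝ (Fin n)} (hu : ‖u‖ = 1) (k ε : ℝ) :
    (stdGaussian (Noise q n)).real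
        {z | ¬ ((∀ v ∈ N, k / 2 ≤ ∑ i, inner ℝ (tensor (w i) v) z ^ 2) ∧
          ‖z‖ ^ 2 ≤ 4 * q * k ∧
          ∑ a, inner ℝ (tensor u (EuclideanSpace.basisFun (Fin q) ℝ a)) z ^ 2 ≤ ε * k / 9)} ≤
      Real.exp (-(ε * k) / 36 + q / 2) +
      (N.card * (Real.exp (k / 4) * (2 : ℝ) ^ (-((d : ℝ) / 2))) +
      Real.exp (-(q * k)) * (1 / 2 : ℝ) ^ (-((n * q : ℕ) / 2 : ℝ))) := by
  set P := stdGaussian (Noise q n)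
  have h1 : ∀ v ∈ N, P.real {z | ∑ i, inner ℝ (tensor (w i) v) z ^ 2 < k / 2} ≤
      Real.exp (k / 4) * (2 : ℝ) ^ (-((d : ℝ) / 2)) := by
    intro v hv
    refine (measureReal_mono (fun z hz => ?_)).trans
      ((stdGaussian_real_chiSq_le (orthonormal_tensor_left hw (hN v hv))
        (c := -(1 / 2)) (by norm_num) (k / 2)).trans_eq ?_)
    · simp only [Set.mem_ofPred_eq] at hz ⊢
      linarith
    · rw [Fintype.card_fin]
      congr 2
      · ring
      · norm_num
  have h2 : P.real {z | 4 * q * k < ‖z‖ ^ 2} ≤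
      Real.exp (-(q * k)) * (1 / 2 : ℝ) ^ (-((n * q : ℕ) / 2 : ℝ)) := by
    have hfin : Module.finrank ℝ (Noise q n) = n * q := by
      rw [(WithLp.linearEquiv 2 ℝ (Fin n → EuclideanSpace ℝ (Fin q))).finrank_eq,
        Module.finrank_pi_fintype]
      simp
    have hb := stdGaussian_real_chiSq_le (stdOrthonormalBasis ℝ (Noise q n)).orthonormal
      (c := 1 / 4) (by norm_num) (4 * q * k)
    rw [Fintype.card_fin] at hb
    refine (measureReal_mono (fun z hz => ?_)).trans (hb.trans_eq ?_)
    · simp only [Set.mem_ofPred_eq] at hz ⊢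
      have := (stdOrthonormalBasis ℝ (Noise q n)).sum_sq_norm_inner_right z
      simp only [Real.norm_eq_abs, sq_abs] at this
      rw [this]
      linarith
    · rw [hfin]
      congr 2
      · ring
      · norm_num
  have h3 : P.real {z | ε * k / 9 <
      ∑ a, inner ℝ (tensor u (EuclideanSpace.basisFun (Fin q) ℝ a)) z ^ 2} ≤
      Real.exp (-(ε * k) / 36 + q / 2) := by
    refine (measureReal_mono (fun z hz => ?_)).trans
      ((stdGaussian_real_chiSq_le (orthonormal_tensor_right
        (EuclideanSpace.basisFun (Fin q) ℝ).orthonormal hu)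
        (c := 1 / 4) (by norm_num) (ε * k / 9)).trans ?_)
    · simp only [Set.mem_ofPred_eq] at hz ⊢
      linarith
    · rw [Fintype.card_fin, Real.exp_add]
      have hl := Real.log_two_lt_d9
      gcongr
      · linarith
      · rw [Real.rpow_def_of_pos (by norm_num)]
        apply Real.exp_le_exp.2
        rw [show (1 - 2 * (1 / 4) : ℝ) = 2⁻¹ by norm_num, Real.log_inv]
        have : (0 : ℝ) ≤ q := by positivity
        nlinarith
  have h4 : {z : Noise q n | ¬ ((∀ v ∈ N, k / 2 ≤ ∑ i, inner ℝ (tensor (w i) v) z ^ 2) ∧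
          ‖z‖ ^ 2 ≤ 4 * q * k ∧
          ∑ a, inner ℝ (tensor u (EuclideanSpace.basisFun (Fin q) ℝ a)) z ^ 2 ≤ ε * k / 9)} ⊆
      {z | ε * k / 9 < ∑ a, inner ℝ (tensor u (EuclideanSpace.basisFun (Fin q) ℝ a)) z ^ 2} ∪
      ((⋃ v ∈ N, {z | ∑ i, inner ℝ (tensor (w i) v) z ^ 2 < k / 2}) ∪
      {z | 4 * q * k < ‖z‖ ^ 2}) := by
    intro z hz
    simp only [Set.mem_union, Set.mem_iUnion, Set.mem_ofPred_eq, exists_prop] at hz ⊢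
    by_contra hcon
    push Not at hcon
    exact hz ⟨hcon.2.1, hcon.2.2, hcon.1⟩
  refine (measureReal_mono h4).trans ((measureReal_union_le _ _).trans ?_)
  refine add_le_add h3 ((measureReal_union_le _ _).trans (add_le_add ?_ h2))
  refine (measureReal_biUnion_finset_le _ _).trans ?_
  rw [← nsmul_eq_mul]
  exact Finset.sum_le_card_nsmul _ _ _ h1

/-- The remainder in the tail of the `t`-distribution is negligible, because `3/2 > exp (1/4)`. -/
lemma exists_forall_tail_remainder_le (q : ℕ) (C : ℝ) :
    ∃ K : ℝ, ∀ k : ℝ, K ≤ k →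
      C * (k + 1) ^ ((q : ℝ) / 2) * (3 / 2 : ℝ) ^ (-((k + 1) / 2)) ≤
        2 * Real.exp (-(1 / 8) * (Real.sqrt k - 2 * Real.sqrt q) ^ 2) := by
  have h1 := (tendsto_rpow_mul_exp_neg_mul_atTop_nhds_zero ((q : ℝ) / 2) 0.075
    (by norm_num)).const_mul |C|
  rw [mul_zero] at h1
  obtain ⟨K, hK⟩ := Filter.eventually_atTop.1 (h1.eventually_le_const (show (0 : ℝ) < 2 by norm_num))
  refine ⟨max K q, fun k hk => ?_⟩
  have hkK : K ≤ k + 1 := by have := (le_max_left K q).trans hk; linarith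
  have hkq : (q : ℝ) ≤ k := (le_max_right K q).trans hk
  have hk0 : 0 ≤ k := (Nat.cast_nonneg q).trans hkq
  have h2 := hK (k + 1) hkK
  have h3 : (3 / 2 : ℝ) ^ (-((k + 1) / 2)) ≤ Real.exp (-0.2 * (k + 1)) := by
    rw [Real.rpow_def_of_pos (by norm_num)]
    apply Real.exp_le_exp.2
    have h4 := Real.le_log_one_add_of_nonneg (show (0 : ℝ) ≤ 1 / 2 by norm_num)
    norm_num at h4
    nlinarith
  have h5 : (Real.sqrt k - 2 * Real.sqrt q) ^ 2 ≤ k + 1 := by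
    have h6 : Real.sqrt q ≤ Real.sqrt k := Real.sqrt_le_sqrt hkq
    have h7 := Real.sq_sqrt hk0
    have h8 : 0 ≤ Real.sqrt q := Real.sqrt_nonneg _
    nlinarith
  calc C * (k + 1) ^ ((q : ℝ) / 2) * (3 / 2 : ℝ) ^ (-((k + 1) / 2))
      ≤ |C| * (k + 1) ^ ((q : ℝ) / 2) * Real.exp (-0.2 * (k + 1)) := by
        gcongr
        exact le_abs_self C
    _ = |C| * ((k + 1) ^ ((q : ℝ) / 2) * Real.exp (-0.075 * (k + 1))) *
          Real.exp (-(1 / 8) * (k + 1)) := by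
        rw [show Real.exp (-0.2 * (k + 1)) =
          Real.exp (-0.075 * (k + 1)) * Real.exp (-(1 / 8) * (k + 1)) by
            rw [← Real.exp_add]; ring_nf]
        ring
    _ ≤ 2 * Real.exp (-(1 / 8) * (k + 1)) := by gcongr
    _ ≤ _ := by
        gcongr 2 * ?_
        apply Real.exp_le_exp.2
        linarith

/-- For a single model whose residual dimension `n - |M|` exceeds a constant, the bound on the
fiducial expectation holds outside of an exceptional event of small probability. -/
lemma exists_forall_model {q : ℕ} (hq : 0 < q) {V : Matrix (Fin q) (Fin q) ℝ} (hV : V.PosDef) :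
    ∃ K : ℝ, ∀ (p n : ℕ) (X : Matrix (Fin p) (Fin n) ℝ) (Mo : Finset (Fin p))
      (B0 : Matrix (Fin q) Mo ℝ) (M : Finset (Fin p)) (j : Fin p) (ε : ℝ), 0 < ε → j ∈ M →
      K ≤ (n : ℝ) - M.card → 0 < (n : ℝ) - M.card → (n : ℝ) ≤ 2 * ((n : ℝ) - M.card) →
      9 / (eigMin V * ((n : ℝ) - M.card)) * dropChange X Mo B0 M j < ε →
      ∃ bad : Set (Noise q n),
        (stdGaussian (Noise q n)).real bad ≤
          Real.exp (-(ε * ((n : ℝ) - M.card)) / 36 + q / 2) +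
            2 * Real.exp (-0.04 * ((n : ℝ) - M.card)) ∧
        ∀ z ∉ bad, expectedH X (dataMatrix (sample (B0 * rowsOf X Mo) V z)) ε M ≤
          hBound n q M.card ε := by
  have hqs : 0 < Real.sqrt q := Real.sqrt_pos.2 (by exact_mod_cast hq)
  obtain ⟨N, hN1, hN⟩ := exists_finset_net q (show 0 < 1 / (40 * Real.sqrt q) by positivity)
  obtain ⟨K₁, hK₁⟩ := exists_forall_chiSq_bounds_le hq N.card
  obtain ⟨C, -, hC⟩ := exists_lintegral_tail_le hq
  obtain ⟨K₂, hK₂⟩ := exists_forall_tail_remainder_le q C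
  refine ⟨max (max K₁ K₂) (2 * q), ?_⟩
  intro p n X Mo B0 M j ε hε hj hK hk hn hred
  have hkK₁ := ((le_max_left _ _).trans (le_max_left _ _)).trans hK
  have hkK₂ := ((le_max_right _ _).trans (le_max_left _ _)).trans hK
  have hkq := (le_max_right _ _).trans hK
  have hbound0 : 0 ≤ hBound n q M.card ε := by unfold hBound; positivity
  by_cases hres : ∃ i ∈ M, dropResidual X M i = 0
  · obtain ⟨i, hi, hi0⟩ := hres
    refine ⟨∅, ?_, fun z _ => ?_⟩
    · rw [measureReal_empty]; positivity
    · rw [expectedH_eq_zero hε hi hi0]; exact hbound0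
  push Not at hres
  have hind := linearIndependent_of_dropResidual_ne_zero hres
  obtain ⟨d, w, hd, hw, hwX, hwμ⟩ := exists_orthonormal_residual X M (B0 * rowsOf X Mo)
  have hu := norm_dropDirection (hres j hj)
  have hd' : (n : ℝ) - M.card ≤ d + q := by
    have : (n : ℝ) ≤ d + M.card + q := by exact_mod_cast hd
    linarith
  set k : ℝ := (n : ℝ) - M.card with hkdef
  obtain ⟨hb1, hb2⟩ := hK₁ k n d hkK₁ hk hn hd'
  refine ⟨_, (stdGaussian_real_bad_le N hN1 hw hu k ε).trans (by linarith), fun z hz => ?_⟩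
  simp only [Set.mem_ofPred_eq, not_not] at hz
  obtain ⟨hz1, hz2, hz3⟩ := hz
  have hμu : 9 / (eigMin V * k) *
      ∑ a, (B0 * rowsOf X Mo).mulVec (dropDirection X M j).ofLp a ^ 2 ≤ ε := by
    have hlam := (eigMin_facts hq hV).1
    refine le_trans ?_ hred.le
    have := sum_sq_mulVec_le_dropChange (B0 := B0) hj (hres j hj)
    gcongr
  obtain ⟨hS, hY⟩ := standardized_data_le hq hV hw hwX hwμ hk (N := N) hN hz2 hz1 hz3 hμu
  refine expectedH_le hε hbound0 hj hind hS hY ?_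
  rw [← hkdef]
  refine (hC (k + 1) (9 / 64 * ε) (by linarith) (by positivity)).trans ?_
  gcongr
  rw [hBound, ← hkdef]
  refine add_le_add (Real.exp_le_exp.2 ?_) (hK₂ k hkK₂)
  have hm : (1 : ℝ) ≤ M.card := by exact_mod_cast Finset.card_pos.2 ⟨j, hj⟩
  have hq0 : (0 : ℝ) ≤ q := by positivity
  have h1 : (q : ℝ) ≤ q * M.card := le_mul_of_one_le_right hq0 hm
  have h2 : 0 ≤ ε * k := by positivity
  nlinarith

/-! ### All models together -/

/-- A model outside `M_o` is nonempty, so its size is one of at most `x` values; there are at most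
`p ^ m` models of size `m`. -/
lemma card_models_le {p : ℕ} (Mo : Finset (Fin p)) {x : ℝ} (hx : 0 ≤ x) :
    ((Finset.univ.filter fun M : Finset (Fin p) => ¬ M ⊆ Mo ∧ (M.card : ℝ) ≤ x).card : ℝ) ≤
      x * Real.exp (x * Real.log p) := by
  set F := ⌊x⌋₊ with hF
  rcases Nat.eq_zero_or_pos p with rfl | hp
  · have : (Finset.univ.filter fun M : Finset (Fin 0) => ¬ M ⊆ Mo ∧ (M.card : ℝ) ≤ x) = ∅ := by
      apply Finset.filter_eq_empty_iff.2
      intro M _ h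
      apply h.1
      intro i
      exact i.elim0
    rw [this]
    simp only [Finset.card_empty, Nat.cast_zero]
    positivity
  have h1 : (Finset.univ.filter fun M : Finset (Fin p) => ¬ M ⊆ Mo ∧ (M.card : ℝ) ≤ x) ⊆
      (Finset.Icc 1 F).biUnion fun m => Finset.powersetCard m Finset.univ := by
    intro M hM
    simp only [Finset.mem_filter, Finset.mem_univ, true_and] at hM
    simp only [Finset.mem_biUnion, Finset.mem_Icc, Finset.mem_powersetCard_univ]
    refine ⟨M.card, ⟨?_, Nat.le_floor hM.2⟩, rfl⟩
    apply Finset.card_pos.2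
    by_contra h
    rw [Finset.not_nonempty_iff_eq_empty] at h
    exact hM.1 (by simp [h])
  have h2 : (Finset.univ.filter fun M : Finset (Fin p) => ¬ M ⊆ Mo ∧ (M.card : ℝ) ≤ x).card ≤
      F * p ^ F := by
    refine (Finset.card_le_card h1).trans (Finset.card_biUnion_le.trans ?_)
    refine (Finset.sum_le_card_nsmul _ _ (p ^ F) fun m hm => ?_).trans_eq ?_
    · rw [Finset.card_powersetCard, Finset.card_univ, Fintype.card_fin]
      exact (Nat.choose_le_pow p m).trans (Nat.pow_le_pow_right hp (Finset.mem_Icc.1 hm).2)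
    · simp
  have hFx : (F : ℝ) ≤ x := Nat.floor_le hx
  have hp0 : (0 : ℝ) < p := by exact_mod_cast hp
  have hlog : 0 ≤ Real.log p := Real.log_natCast_nonneg p
  calc _ ≤ ((F * p ^ F : ℕ) : ℝ) := by exact_mod_cast h2
    _ = F * Real.exp (F * Real.log p) := by
      push_cast
      rw [← Real.log_pow, Real.exp_log (by positivity)]
    _ ≤ _ := by gcongr

lemma eventually_rpow_le_half {α : ℝ} (hα1 : α < 1) :
    ∀ᶠ n : ℕ in atTop, (n : ℝ) ^ α ≤ n / 2 := by
  have h1 := (tendsto_rpow_neg_atTop (show 0 < 1 - α by linarith)).comp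
    tendsto_natCast_atTop_atTop
  filter_upwards [h1.eventually_le_const (show (0 : ℝ) < 1 / 2 by norm_num),
    eventually_gt_atTop 0] with n hn hn0
  have hn0' : (0 : ℝ) < n := by exact_mod_cast hn0
  have h2 : (n : ℝ) ^ α = n * (n : ℝ) ^ (-(1 - α)) := by
    rw [show α = 1 + -(1 - α) by ring, Real.rpow_add hn0', Real.rpow_one]
    ring_nf
  rw [h2]
  simp only [Function.comp_apply] at hn
  nlinarith

lemma measurable_sample {q n : ℕ} (μ : Matrix (Fin q) (Fin n) ℝ)
    (V : Matrix (Fin q) (Fin q) ℝ) : Measurable (sample μ V) := by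
  unfold sample
  fun_prop

end EAS

end

theorem theorem3 {q : ℕ} (hq : 0 < q) (α : ℝ) (hα0 : 0 < α) (hα1 : α < 1)
    (p : ℕ → ℕ) (X : ∀ n : ℕ, Matrix (Fin (p n)) (Fin n) ℝ)
    (Mo : ∀ n : ℕ, Finset (Fin (p n))) (B0 : ∀ n : ℕ, Matrix (Fin q) (Mo n) ℝ)
    (V : Matrix (Fin q) (Fin q) ℝ)
    -- non-singularity of the true covariance matrix
    (hV : V.PosDef)
    -- growth of the number of predictors, and size of the true model
    (hp : (fun n : ℕ => Real.log (p n : ℝ)) =o[atTop] fun n : ℕ => (n : ℝ) ^ (1 - α))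
    (hMo : ∀ᶠ n : ℕ in atTop, ((Mo n).card : ℝ) ≤ (n : ℝ) ^ α)
    -- the design matrix of the true model has full row rank
    (hX : ∀ᶠ n : ℕ in atTop,
      IsUnit (EAS.rowsOf (X n) (Mo n) * (EAS.rowsOf (X n) (Mo n)).transpose).det) :
    ∀ᶠ n : ℕ in atTop, ∀ ε : ℝ, 0 < ε →
      EAS.Redundancy α (X n) (Mo n) (B0 n) V ε →
      1 - EAS.v4 n (p n) α V ε ≤
        (EAS.matrixNormal (B0 n * EAS.rowsOf (X n) (Mo n)) V).real
          {y | ∀ M : Finset (Fin (p n)), ¬ M ⊆ Mo n → (M.card : ℝ) ≤ (n : ℝ) ^ α →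
            EAS.expectedH (X n) (EAS.dataMatrix y) ε M ≤ EAS.hBound n q M.card ε} := by
  obtain ⟨K, hK⟩ := EAS.exists_forall_model hq hV
  obtain ⟨hlam, hlam', -⟩ := EAS.eigMin_facts hq hV
  filter_upwards [EAS.eventually_rpow_le_half hα1, eventually_gt_atTop 0,
    tendsto_natCast_atTop_atTop.eventually_ge_atTop (2 * K)] with n hn hn0 hnK
  intro ε hε hred
  have hn0' : (0 : ℝ) < n := by exact_mod_cast hn0
  have hna : 1 ≤ (n : ℝ) ^ α := Real.one_le_rpow (by exact_mod_cast hn0) hα0.le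
  set P := ProbabilityTheory.stdGaussian (EAS.Noise q n)
  set μ := B0 n * EAS.rowsOf (X n) (Mo n) with hμ
  set S : Set (Fin n → EuclideanSpace ℝ (Fin q)) :=
    {y | ∀ M : Finset (Fin (p n)), ¬ M ⊆ Mo n → (M.card : ℝ) ≤ (n : ℝ) ^ α →
            EAS.expectedH (X n) (EAS.dataMatrix y) ε M ≤ EAS.hBound n q M.card ε} with hS
  set models := Finset.univ.filter fun M : Finset (Fin (p n)) =>
    ¬ M ⊆ Mo n ∧ (M.card : ℝ) ≤ (n : ℝ) ^ α with hmodels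
  set β := Real.exp (-(ε * ((n : ℝ) - (n : ℝ) ^ α) * EAS.eigMin V) / (36 * EAS.eigMax V) +
      (q : ℝ) * (n : ℝ) ^ α / 2) + 2 * Real.exp (-0.04 * ((n : ℝ) - (n : ℝ) ^ α)) with hβ
  have hmodel : ∀ M : Finset (Fin (p n)), ∃ bad : Set (EAS.Noise q n), M ∈ models →
      P.real bad ≤ β ∧ ∀ z ∉ bad, EAS.expectedH (X n) (EAS.dataMatrix (EAS.sample μ V z)) ε M ≤
        EAS.hBound n q M.card ε := by
    intro M
    by_cases hM : M ∈ models
    swap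
    · exact ⟨∅, fun h => absurd h hM⟩
    have hM' := hM
    simp only [hmodels, Finset.mem_filter, Finset.mem_univ, true_and] at hM'
    obtain ⟨j, hj, -, hjε⟩ := hred M hM'.1 hM'.2
    have hcard := hM'.2
    obtain ⟨bad, hb, hgood⟩ := hK (p n) n (X n) (Mo n) (B0 n) M j ε hε hj (by linarith)
      (by linarith) (by linarith) hjε
    refine ⟨bad, fun _ => ⟨hb.trans ?_, hgood⟩⟩
    refine add_le_add (Real.exp_le_exp.2 (add_le_add ?_ ?_)) ?_
    -- the eigenvalue ratio in the exceptional probability is at most `1`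
    · have hmax : 0 < EAS.eigMax V := hlam.trans_le hlam'
      rw [neg_div, neg_div, neg_le_neg_iff, div_le_div_iff₀ (by positivity) (by norm_num)]
      have h1 : ((n : ℝ) - (n : ℝ) ^ α) * EAS.eigMin V ≤
          ((n : ℝ) - M.card) * EAS.eigMax V := by
        apply mul_le_mul (by linarith) hlam' hlam.le (by linarith)
      nlinarith
    · have : (q : ℝ) ≤ q * (n : ℝ) ^ α := le_mul_of_one_le_right (by positivity) hna
      linarith
    · gcongr 2 * ?_
      apply Real.exp_le_exp.2
      linarith
  choose bad hbad using hmodel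
  have hsum : P.real (⋃ M ∈ models, bad M) ≤ EAS.v4 n (p n) α V ε := by
    have hβ0 : 0 ≤ β := by positivity
    calc P.real (⋃ M ∈ models, bad M) ≤ ∑ M ∈ models, P.real (bad M) :=
          measureReal_biUnion_finset_le _ _
      _ ≤ models.card • β := Finset.sum_le_card_nsmul _ _ _ fun M hM => (hbad M hM).1
      _ = models.card * β := nsmul_eq_mul _ _
      _ ≤ ((n : ℝ) ^ α * Real.exp ((n : ℝ) ^ α * Real.log (p n))) * β := by
          gcongr
          exact EAS.card_models_le (Mo n) (by positivity)
      _ = EAS.v4 n (p n) α V ε := by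
          rw [EAS.v4, hβ, Real.exp_add _ ((n : ℝ) ^ α * Real.log (p n)),
            Real.exp_add _ ((n : ℝ) ^ α * Real.log (p n))]
          ring
  have hcover : (Set.univ : Set (EAS.Noise q n)) ⊆
      EAS.sample μ V ⁻¹' S ∪ ⋃ M ∈ models, bad M := by
    intro z _
    by_cases hz : z ∈ ⋃ M ∈ models, bad M
    · exact Or.inr hz
    · left
      simp only [Set.mem_iUnion, not_exists] at hz
      intro M hM1 hM2
      have hM : M ∈ models := by simp [hmodels, hM1, hM2]
      exact (hbad M hM).2 z (hz M hM)
  have h1 : 1 ≤ P.real (EAS.sample μ V ⁻¹' S) + EAS.v4 n (p n) α V ε := by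
    have h2 := (measureReal_mono (μ := P) hcover).trans (measureReal_union_le _ _)
    rw [probReal_univ] at h2
    linarith
  -- the event need not be measurable: the preimage bounds its outer measure from below
  have h3 : P.real (EAS.sample μ V ⁻¹' S) ≤ (EAS.matrixNormal μ V).real S := by
    have hprob : IsProbabilityMeasure (P.map (EAS.sample μ V)) :=
      Measure.isProbabilityMeasure_map (EAS.measurable_sample μ V).aemeasurable
    rw [EAS.matrixNormal_eq_map]
    exact ENNReal.toReal_mono (measure_ne_top _ _)
      (Measure.le_map_apply (EAS.measurable_sample μ V).aemeasurable S)
  linarith
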